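/- **Theorem 3.** Fix the number $m\ge 1$ of candidates $c_1,\dots,c_m$. The *destructive weighted-protection problem* with $m$ candidates is the following decision problem. *Input:* a scoring rule, that is a vector $\alpha=(\alpha_1,\dots,\alpha_m)\in\mathbb{N}^m$ with $\alpha_1\ge\dots\ge\alpha_m$; a finite list of voters $v_1,\dots,v_n$, each with a weight $w_j\in\mathbb{Z}_{>0}$ and a preference list $\tau_j$ (a permutation of the candidates, a voter giving the candidate at position $i$ of its list the score $w_j\alpha_i$); a defense budget $F\in\mathbb{Z}_{\ge0}$ and an attack budget $B\in\mathbb{Z}_{\ge0}$, where $c_m$ has the highest total score if no voter is bribed. All numbers are written in binary. *Question:* is there a set $\mathcal V_F$ of at most $F$ voters such that for every set $\mathcal V_B$ of at most $B$ voters disjoint from $\mathcal V_F$, and however the preference lists of the voters in $\mathcal V_B$ are replaced, no candidate $c\ne c_m$ gets a strictly higher total score than $c_m$? For every fixed $m\ge1$ this problem is in P: it is decided by a Turing machine whose running time is bounded by a polynomial in the length of the input. (The polynomial depends only on $m$; in particular, the problem is solvable in polynomial time for every scoring rule.) -/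

import Mathlib

open Turing Computability

/-! ### Polynomial time -/

/-- A language over the finite alphabet `Γ` is in the class P: some Turing machine (a multi-stack
machine, on every input string, well-formed or not) computes its characteristic function in a
number of steps that is polynomial in the length of the input string. -/
def InP {Γ : Type} (L : Set (List Γ)) : Prop :=
  ∃ f : List Γ → Bool, (∀ x, f x = true ↔ x ∈ L) ∧
    Nonempty (TM2ComputableInPolyTime (id : List Γ → List Γ) encodeBool f)

/-- A finite sequence of natural numbers as a string over a three-letter alphabet: every number
is written in binary (least significant digit first, without superfluous zeros; the letters
`some false`, `some true` are the binary digits) and is followed by the separator `none`. -/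
def encodeNats (l : List ℕ) : List (Option Bool) :=
  l.flatMap fun n => (encodeNat n).map some ++ [none]

theorem map_some_append_inj {a b : List Bool} {r s : List (Option Bool)}
    (h : a.map some ++ none :: r = b.map some ++ none :: s) : a = b ∧ r = s := by
  induction a generalizing b with
  | nil => cases b <;> simp_all
  | cons x a ih =>
    cases b with
    | nil => simp_all
    | cons y b =>
      simp only [List.map_cons, List.cons_append, List.cons.injEq, Option.some.injEq] at h
      obtain ⟨rfl, rfl⟩ := ih h.2
      simp [h.1]

/-- Different sequences of numbers have different strings. -/
theorem encodeNats_injective : Function.Injective encodeNats := by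
  intro l
  induction l with
  | nil => intro l' h; cases l' <;> simp_all [encodeNats]
  | cons a l ih =>
    intro l' h
    cases l' with
    | nil => simp [encodeNats] at h
    | cons b l' =>
      simp only [encodeNats, List.flatMap_cons, List.append_assoc, List.singleton_append] at h
      obtain ⟨h1, h2⟩ := map_some_append_inj h
      rw [encodingNatBool.encode_injective h1, ih h2]

/-! ### Elections -/

/-- A scoring rule for `m` candidates: `score i` is the score of the candidate at position `i` of
a preference list (position `0` is the top), and scores do not increase down the list. -/
structure ScoringRule (m : ℕ) where
  score : Fin m → ℕ
  antitone_score : Antitone score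

/-- A weighted voter. `pref i` is the candidate at position `i` of the preference list, so that
`pref.symm c` is the position of candidate `c`. -/
structure Voter (m : ℕ) where
  weight : ℕ
  weight_pos : 0 < weight
  pref : Equiv.Perm (Fin m)

/-- An election with `m` candidates: a scoring rule and finitely many weighted voters. -/
structure Election (m : ℕ) where
  rule : ScoringRule m
  voters : List (Voter m)

namespace Election

variable {m : ℕ}

/-- The (indices of the) voters. -/
abbrev V (E : Election m) : Type := Fin E.voters.length

/-- The preference list that voter `j` has before any bribery. -/
def pref (E : Election m) (j : E.V) : Equiv.Perm (Fin m) := (E.voters.get j).pref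

/-- The weight of voter `j`. -/
def weight (E : Election m) (j : E.V) : ℕ := (E.voters.get j).weight

/-- The total weighted score of candidate `c` when voter `j` reports the preference list `τ j`. -/
def totalScore (E : Election m) (τ : E.V → Equiv.Perm (Fin m)) (c : Fin m) : ℕ :=
  ∑ j, E.weight j * E.rule.score ((τ j).symm c)

/-- The preference lists after the voters in `VB` are bribed, the new list of `j ∈ VB` being
`τ' j`. -/
def bribe (E : Election m) (VB : Finset E.V) (τ' : E.V → Equiv.Perm (Fin m)) :
    E.V → Equiv.Perm (Fin m) :=
  fun j => if j ∈ VB then τ' j else E.pref j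

/-- In the absence of bribery, the last candidate is a winner (has the highest total score). -/
def LastWins (E : Election (m + 1)) : Prop :=
  ∀ c, E.totalScore E.pref c ≤ E.totalScore E.pref (Fin.last m)

/-- The defender can protect the last candidate against a destructive attacker, where `pa`, `pb`
are the awarding and the bribing prices, `F` the defense budget and `B` the attack budget: some
set `VF` of voters can be awarded within budget `F` such that, whatever set `VB` of non-awarded
voters is bribed within budget `B`, and whatever their new preference lists are, no other
candidate gets a strictly higher score than the last one. -/
def DestructivelyProtectable (E : Election (m + 1)) (pa pb : E.V → ℕ) (F B : ℕ) : Prop :=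
  ∃ VF : Finset E.V, ∑ j ∈ VF, pa j ≤ F ∧
    ∀ VB : Finset E.V, Disjoint VB VF → ∑ j ∈ VB, pb j ≤ B →
      ∀ τ' : E.V → Equiv.Perm (Fin (m + 1)), ∀ c, c ≠ Fin.last m →
        ¬ E.totalScore (E.bribe VB τ') (Fin.last m) < E.totalScore (E.bribe VB τ') c

end Election

/-! ### The decision problem -/

/-- The data of an instance of the weighted-protection problem (all prices are one): the scoring
rule, the voters, the defense budget and the attack budget. -/
structure WeightedProtectionInstance (m : ℕ) extends Election m where
  defenseBudget : ℕ
  attackBudget : ℕ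

namespace WeightedProtectionInstance

variable {m : ℕ}

/-- An instance as a sequence of numbers: the `m` scores, the two budgets, and for every voter
the weight followed by the `m` candidates on the preference list. -/
def toNats (I : WeightedProtectionInstance m) : List ℕ :=
  List.ofFn I.rule.score ++ [I.defenseBudget, I.attackBudget] ++
    I.voters.flatMap fun v => v.weight :: List.ofFn fun i => (v.pref i : ℕ)

/-- The input string of an instance. -/
def encode (I : WeightedProtectionInstance m) : List (Option Bool) := encodeNats I.toNats

/-- Different instances have different input strings. -/
theorem encode_injective {m : ℕ} :
    Function.Injective (encode : WeightedProtectionInstance m → _) := by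
  rintro ⟨⟨⟨s, hs⟩, vs⟩, F, B⟩ ⟨⟨⟨s', hs'⟩, vs'⟩, F', B'⟩ h
  replace h := encodeNats_injective h
  simp only [toNats, List.append_assoc] at h
  obtain ⟨h1, h2⟩ := List.append_inj h (by simp)
  have h1 := List.ofFn_injective h1
  simp only [List.cons_append, List.nil_append, List.cons.injEq] at h2
  obtain ⟨rfl, rfl, h3⟩ := h2
  subst h1
  suffices vs = vs' by subst this; rfl
  clear h
  induction vs generalizing vs' with
  | nil => cases vs' <;> simp_all
  | cons v vs ih =>
    cases vs' with
    | nil => simp at h3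
    | cons v' vs' =>
      simp only [List.flatMap_cons] at h3
      obtain ⟨h4, h5⟩ := List.append_inj h3 (by simp)
      rw [ih _ h5]
      congr 1
      obtain ⟨w, hw, p⟩ := v
      obtain ⟨w', hw', p'⟩ := v'
      simp only [List.cons.injEq] at h4
      obtain ⟨rfl, h6⟩ := h4
      have : p = p' := by
        ext i
        exact congrFun (List.ofFn_injective h6) i
      subst this; rfl

end WeightedProtectionInstance

/-- The destructive weighted-protection problem with `m + 1` candidates, as a language: the input
strings of those instances (in which the last candidate wins without bribery) where the defender
can succeed, all awarding and bribing prices being one. -/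
def destructiveWeightedProtection (m : ℕ) : Set (List (Option Bool)) :=
  {x | ∃ I : WeightedProtectionInstance (m + 1), I.encode = x ∧ I.LastWins ∧
    I.DestructivelyProtectable (fun _ => 1) (fun _ => 1) I.defenseBudget I.attackBudget}

/-!
The candidates being fixed in number, there are only constantly many preference lists, and two
voters with the same list differ by their weights alone. An attacker who wants a candidate `c` to
beat the last one puts `c` on top and the last candidate at the bottom of every bribed list, and for
voters with the same list the effect of this grows with the weight. So an attacker loses nothing by
bribing, among the unprotected voters with a given list, the heaviest ones, and, by an exchange
argument, the defender loses nothing by protecting the heaviest voters with each list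
(`protect_iff_thresholds`). After sorting the voters by weight, both players may therefore restrict
themselves to one threshold for each preference list (`unitProtectable_iff_thresholds`). With `n`
voters and `k` preference lists there are at most `(n + 1) ^ k` such choices for each player, a
polynomial number as `k` is fixed, and `decideData` tries them all.

To see that this search runs in polynomial time on a Turing machine, structured programs over stacks
(`Prog`) are compiled to multi-stack machines that simulate them step by step (`Prog.Run.reach`). On
top of these, the functions on binary trees that programs compute in polynomial time (`FPTree`), and
the functions between types encoded as trees (`PolyFn`), are shown to be closed under composition,
pairing, case distinctions and, above all, folding over a list as long as the accumulator grows only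
by a bounded amount in each step (`PolyFn.foldl_measure`, from `FPTree.iterate_until`). Binary
arithmetic, sorting, the exhaustive search and the recognition of well-formed inputs (`parse`) are
all obtained from folds. The search is a nesting of loops over the end segments of the list of
voters, and the depth of the nesting is the number of preference lists, a constant.
-/

/-! ### A structured language for stack machines -/

/-- The stack alphabet. -/
abbrev Letter : Type := Option Bool

/-- Structured programs over stacks indexed by `ℕ`. `pop k P` pops stack `k` and continues with
`P none` if the stack was empty and with `P (some a)` if the symbol `a` was popped. `loop k P` pops
stack `k` until it is empty and runs `P a` after popping the symbol `a`; the body may push on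
stack `k`. -/
inductive Prog : Type
  | skip
  | push (k : ℕ) (a : Letter)
  | seq (P Q : Prog)
  | pop (k : ℕ) (P : Option Letter → Prog)
  | loop (k : ℕ) (P : Letter → Prog)

/-- The contents of all stacks. -/
abbrev Store : Type := ℕ → List Letter

namespace Prog

/-- `Run P s s' t`: the program `P`, started in the store `s`, ends in the store `s'` after exactly
`t` steps of the machine it is compiled to. -/
inductive Run : Prog → Store → Store → ℕ → Prop
  | skip (s) : Run skip s s 1
  | push (s k a) : Run (push k a) s (Function.update s k (a :: s k)) 1
  | seq {P Q s s' s'' t t'} : Run P s s' t → Run Q s' s'' t' → Run (seq P Q) s s'' (t + t')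
  | pop {k P s s' t} : Run (P (s k).head?) (Function.update s k (s k).tail) s' t →
      Run (pop k P) s s' (1 + t)
  | loop_nil {k P s} : s k = [] → Run (loop k P) s s 1
  | loop_cons {k P s s' s'' a l t t'} : s k = a :: l → Run (P a) (Function.update s k l) s' t →
      Run (loop k P) s' s'' t' → Run (loop k P) s s'' (1 + t + t')

/-- A strict bound for the indices of the stacks that a program uses. -/
def bound : Prog → ℕ
  | skip => 0
  | push k _ => k + 1
  | seq P Q => max P.bound Q.bound
  | pop k P => max (k + 1) (Finset.univ.sup fun a => (P a).bound)
  | loop k P => max (k + 1) (Finset.univ.sup fun a => (P a).bound)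

/-- The labels of the compiled program. -/
def Lab : Prog → Type
  | skip => Unit
  | push _ _ => Unit
  | seq P Q => Lab P ⊕ Lab Q
  | pop _ P => Option (Σ a, Lab (P a))
  | loop _ P => Option (Σ a, Lab (P a))

instance fintypeLab : (P : Prog) → Fintype (Lab P)
  | skip => inferInstanceAs (Fintype Unit)
  | push _ _ => inferInstanceAs (Fintype Unit)
  | seq P Q =>
    have := fintypeLab P
    have := fintypeLab Q
    inferInstanceAs (Fintype (Lab P ⊕ Lab Q))
  | pop _ P =>
    have := fun a => fintypeLab (P a)
    inferInstanceAs (Fintype (Option (Σ a, Lab (P a))))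
  | loop _ P =>
    have := fun a => fintypeLab (P a)
    inferInstanceAs (Fintype (Option (Σ a, Lab (P a))))

/-- The label at which the compiled program starts. -/
def entry : (P : Prog) → Lab P
  | skip => ()
  | push _ _ => ()
  | seq P _ => Sum.inl (entry P)
  | pop _ _ => none
  | loop _ _ => none

/-- The stack alphabets of the compiled machine: the stack `some i` is stack `i` of the program,
and `none` is a separate output stack. -/
@[reducible] def Alph (N : ℕ) : Option (Fin (N + 1)) → Type
  | none => Bool
  | some _ => Letter

/-- The compiled program, as a part of a machine with label type `Λ`: `emb` embeds the labels of
the program, and the program ends by a jump to `ex`. The internal state of the machine holds the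
result of the last `pop`. -/
def compile (N : ℕ) {Λ : Type} :
    (P : Prog) → (Lab P → Λ) → Λ → Lab P → TM2.Stmt (Alph N) Λ (Option Letter)
  | skip, _, ex, _ => .goto fun _ => ex
  | push k a, _, ex, _ => .push (some (Fin.ofNat (N + 1) k)) (fun _ => a) (.goto fun _ => ex)
  | seq P Q, emb, _, .inl l => compile N P (fun l => emb (.inl l)) (emb (.inr (entry Q))) l
  | seq _ Q, emb, ex, .inr l => compile N Q (fun l => emb (.inr l)) ex l
  | pop k P, emb, _, none => .pop (some (Fin.ofNat (N + 1) k)) (fun _ a => a)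
      (.goto fun v => emb (some ⟨v, entry (P v)⟩))
  | pop _ P, emb, ex, some ⟨v, l⟩ => compile N (P v) (fun l => emb (some ⟨v, l⟩)) ex l
  | loop k P, emb, ex, none => .pop (some (Fin.ofNat (N + 1) k)) (fun _ a => a)
      (.goto fun v => v.elim ex fun a => emb (some ⟨a, entry (P a)⟩))
  | loop _ P, emb, _, some ⟨a, l⟩ => compile N (P a) (fun l => emb (some ⟨a, l⟩)) (emb none) l

/-- The stacks of the compiled machine that correspond to a store. -/
def machineStk (N : ℕ) (s : Store) : ∀ k, List (Alph N k)
  | none => []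
  | some i => s i

/-- For `k ≤ N` the stack index `Fin.ofNat (N + 1) k` of the compiled machine does not wrap
around. -/
theorem update_machineStk {N k : ℕ} (hk : k ≤ N) (s : Store) (x : List Letter) :
    Function.update (machineStk N s) (some (Fin.ofNat (N + 1) k)) x =
      machineStk N (Function.update s k x) := by
  have hv : (Fin.ofNat (N + 1) k : ℕ) = k := Nat.mod_eq_of_lt (by omega)
  funext i
  cases i with
  | none => simp [machineStk]
  | some i =>
    by_cases h : i = Fin.ofNat (N + 1) k
    · subst h
      simp [machineStk, Nat.mod_eq_of_lt (show k < N + 1 by omega)]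
    · have h' : (i : ℕ) ≠ k := fun h' => h (Fin.ext (h'.trans hv.symm))
      rw [Function.update_of_ne (by simpa using h)]
      simp [machineStk, h']

theorem machineStk_apply {N k : ℕ} (hk : k ≤ N) (s : Store) :
    machineStk N s (some (Fin.ofNat (N + 1) k)) = s k := by
  simp [machineStk, Nat.mod_eq_of_lt (show k < N + 1 by omega)]

/-- The machine `M` goes from the configuration `c` to `c'` in exactly `n` steps. -/
def Reach {N : ℕ} {Λ : Type} (M : Λ → TM2.Stmt (Alph N) Λ (Option Letter)) (n : ℕ)
    (c c' : TM2.Cfg (Alph N) Λ (Option Letter)) : Prop :=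
  (flip bind (TM2.step M))^[n] (some c) = some c'

theorem Reach.trans {N : ℕ} {Λ : Type} {M : Λ → TM2.Stmt (Alph N) Λ (Option Letter)} {n n' : ℕ}
    {c c' c'' : TM2.Cfg (Alph N) Λ (Option Letter)} (h : Reach M n c c') (h' : Reach M n' c' c'') :
    Reach M (n + n') c c'' := by
  have e := Function.iterate_add_apply (flip bind (TM2.step M)) n' n (some c)
  rw [add_comm n' n] at e
  exact e.trans ((congrArg _ h).trans h')

theorem Reach.single {N : ℕ} {Λ : Type} {M : Λ → TM2.Stmt (Alph N) Λ (Option Letter)}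
    {c c' : TM2.Cfg (Alph N) Λ (Option Letter)} (h : TM2.step M c = some c') : Reach M 1 c c' := h

/-- The compiled program simulates the program step by step, from whatever internal state `v`. -/
theorem Run.reach {N : ℕ} {Λ : Type} {M : Λ → TM2.Stmt (Alph N) Λ (Option Letter)} {P : Prog}
    {s s' : Store} {t : ℕ} (h : Run P s s' t) (hN : P.bound ≤ N + 1) {emb : Lab P → Λ} {ex : Λ}
    (hM : ∀ l, M (emb l) = compile N P emb ex l) (v : Option Letter) :
    ∃ v', Reach M t ⟨some (emb P.entry), v, machineStk N s⟩ ⟨some ex, v', machineStk N s'⟩ := by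
  induction h generalizing v ex with
  | skip s =>
    refine ⟨v, Reach.single ?_⟩
    simp only [TM2.step, hM, compile, TM2.stepAux]
  | push s k a =>
    simp only [bound] at hN
    refine ⟨v, Reach.single ?_⟩
    simp only [TM2.step, hM, compile, TM2.stepAux]
    rw [machineStk_apply (by omega), update_machineStk (by omega)]
  | seq _ _ ih ih' =>
    simp only [bound, max_le_iff] at hN
    obtain ⟨v', h⟩ := ih hN.1 (emb := fun l => emb (.inl l)) (fun l => hM (.inl l)) v
    obtain ⟨v'', h'⟩ := ih' hN.2 (emb := fun l => emb (.inr l)) (fun l => hM (.inr l)) v'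
    exact ⟨v'', h.trans h'⟩
  | @pop k P s s' t _ ih =>
    simp only [bound, max_le_iff, Finset.sup_le_iff] at hN
    obtain ⟨v', h⟩ := ih (hN.2 _ (Finset.mem_univ _)) (emb := fun l => emb (some ⟨_, l⟩))
      (fun l => hM (some ⟨_, l⟩)) (s k).head?
    refine ⟨v', (Reach.single ?_).trans h⟩
    rw [TM2.step, hM]
    simp only [entry, compile, TM2.stepAux]
    rw [machineStk_apply (by omega), update_machineStk (by omega)]
  | @loop_nil k P s hs =>
    simp only [bound, max_le_iff, Finset.sup_le_iff] at hN
    refine ⟨none, Reach.single ?_⟩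
    rw [TM2.step, hM]
    simp only [entry, compile, TM2.stepAux]
    rw [machineStk_apply (by omega), update_machineStk (by omega),
      show (s k).tail = s k by simp [hs], Function.update_eq_self, hs]
    rfl
  | @loop_cons k P s s' s'' a l t t' hs _ _ ih ih' =>
    simp only [bound, max_le_iff, Finset.sup_le_iff] at hN
    obtain ⟨v', h⟩ := ih (hN.2 _ (Finset.mem_univ _)) (emb := fun l => emb (some ⟨_, l⟩))
      (fun l => hM (some ⟨_, l⟩)) (some a)
    obtain ⟨v'', h'⟩ := ih' (by simpa [bound] using hN) hM (ex := ex) v'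
    refine ⟨v'', ((Reach.single ?_).trans h).trans h'⟩
    rw [TM2.step, hM]
    simp only [entry, compile, TM2.stepAux]
    rw [machineStk_apply (by omega), update_machineStk (by omega), hs]
    rfl

/-- The store with the stack `x` in front of the stacks of `s`. -/
def push0 (x : List Letter) (s : Store) : Store
  | 0 => x
  | k + 1 => s k

infixr:67 " ∷ₛ " => push0

/-- The store with empty stacks. -/
def empty : Store := fun _ => []

/-- The machine that runs a program and then moves the symbol on stack `0` to the output stack. -/
def machine (P : Prog) : FinTM2 where
  K := Option (Fin (P.bound + 1))
  k₀ := some 0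
  k₁ := none
  Γ := Alph P.bound
  Λ := Option (Lab P)
  main := some P.entry
  σ := Option Letter
  initialState := none
  m
    | some l => compile P.bound P some none l
    | none => .pop (some 0) (fun _ a => a)
        (.push none (fun v => v.join.getD false) (.load (fun _ => none) .halt))

/-- A program that, within a polynomial number of steps, replaces the input string on stack `0` by
the single letter `some (f x)`, leaving all other stacks empty, shows that `f` is computable in
polynomial time. -/
theorem computable_of_run {f : List Letter → Bool} (P : Prog) (p : Polynomial ℕ)
    (h : ∀ x, ∃ t ≤ p.eval x.length, Run P (x ∷ₛ empty) ([some (f x)] ∷ₛ empty) t) :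
    Nonempty (TM2ComputableInPolyTime (id : List Letter → List Letter) encodeBool f) := by
  choose t ht h using h
  have key : ∀ x, (flip bind (TM2.step P.machine.m))^[t x + 1] (some (initList P.machine x)) =
      some (haltList P.machine [f x]) := by
    intro x
    obtain ⟨v', h'⟩ := (h x).reach (N := P.bound) (M := P.machine.m) (emb := some) (ex := none)
      (by omega) (fun l => rfl) none
    have e1 : initList P.machine x =
        ⟨some (some P.entry), none, machineStk P.bound (x ∷ₛ empty)⟩ := by
      simp only [initList]
      congr 1
      funext k
      match k with
      | none => rfl
      | some ⟨0, _⟩ => rfl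
      | some ⟨k + 1, hk⟩ => rfl
    have e2 : TM2.step P.machine.m ⟨some none, v', machineStk P.bound ([some (f x)] ∷ₛ empty)⟩ =
        some (haltList P.machine [f x]) := by
      simp only [TM2.step, machine, TM2.stepAux, haltList]
      congr 2
      funext k
      match k with
      | none => rfl
      | some ⟨0, _⟩ => rfl
      | some ⟨k + 1, hk⟩ => rfl
    rw [e1]
    exact h'.trans (Reach.single e2)
  exact ⟨{ tm := P.machine
           inputAlphabet := Equiv.refl _
           outputAlphabet := Equiv.refl _
           time := p + 1
           outputsFun := fun x =>
            { steps := t x + 1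
              evals_in_steps := by
                have e : List.map (fun a => a) x = x := List.map_id x
                exact (congrArg (fun y => (flip bind (TM2.step P.machine.m))^[t x + 1]
                  (some (initList P.machine y))) e).trans (key x)
              steps_le_m := by simpa using ht x } }⟩

end Prog

/-! ### Programs for elementary stack operations -/

namespace Prog

@[simp] theorem push0_zero (x : List Letter) (s : Store) : (x ∷ₛ s) 0 = x := rfl

@[simp] theorem push0_succ (x : List Letter) (s : Store) (k : ℕ) : (x ∷ₛ s) (k + 1) = s k := rfl

@[simp] theorem update_push0_zero (x v : List Letter) (s : Store) :
    Function.update (x ∷ₛ s) 0 v = v ∷ₛ s := by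
  funext k; cases k <;> simp [Function.update]

@[simp] theorem update_push0_succ (x v : List Letter) (s : Store) (k : ℕ) :
    Function.update (x ∷ₛ s) (k + 1) v = x ∷ₛ Function.update s k v := by
  funext j; cases j <;> simp [Function.update]

@[simp] theorem nil_push0_empty : [] ∷ₛ empty = empty := by
  funext k; cases k <;> rfl

@[simp] theorem empty_apply (k : ℕ) : empty k = [] := rfl

@[simp] theorem update_empty_zero (v : List Letter) : Function.update empty 0 v = v ∷ₛ empty := by
  funext k; cases k <;> simp [Function.update]

@[simp] theorem update_empty_succ (v : List Letter) (k : ℕ) :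
    Function.update empty (k + 1) v = [] ∷ₛ Function.update empty k v := by
  funext j; cases j <;> simp [Function.update]

/-- The program that acts like `P` on the stacks `1, 2, …`. -/
def shift : Prog → Prog
  | skip => skip
  | push k a => push (k + 1) a
  | seq P Q => seq P.shift Q.shift
  | pop k P => pop (k + 1) fun a => (P a).shift
  | loop k P => loop (k + 1) fun a => (P a).shift

theorem Run.shift {P : Prog} {s s' : Store} {t : ℕ} (h : Run P s s' t) (x : List Letter) :
    Run P.shift (x ∷ₛ s) (x ∷ₛ s') t := by
  induction h with
  | skip s => exact .skip _
  | push s k a =>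
    have := Run.push (x ∷ₛ s) (k + 1) a
    rwa [update_push0_succ] at this
  | seq _ _ ih ih' => exact .seq ih ih'
  | pop _ ih => exact .pop (by simpa using ih)
  | loop_nil hs => exact .loop_nil (by simpa using hs)
  | loop_cons hs _ _ ih ih' => exact .loop_cons (by simpa using hs) (by simpa using ih) ih'

/-- The program `P` leads from the store `s` to `s'` in at most `n` steps. -/
def Does (P : Prog) (s s' : Store) (n : ℕ) : Prop := ∃ t ≤ n, Run P s s' t

namespace Does

variable {P Q : Prog} {s s' s'' : Store} {n n' : ℕ}

theorem mono (h : Does P s s' n) (hn : n ≤ n') : Does P s s' n' := by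
  obtain ⟨t, ht, h⟩ := h
  exact ⟨t, ht.trans hn, h⟩

theorem seq (h : Does P s s' n) (h' : Does Q s' s'' n') : Does (seq P Q) s s'' (n + n') := by
  obtain ⟨t, ht, h⟩ := h
  obtain ⟨t', ht', h'⟩ := h'
  exact ⟨t + t', by omega, h.seq h'⟩

theorem skip : Does skip s s 1 := ⟨1, le_rfl, .skip s⟩

theorem push {k : ℕ} {a : Letter} (h : Function.update s k (a :: s k) = s') :
    Does (push k a) s s' 1 := ⟨1, le_rfl, h ▸ .push s k a⟩

theorem pop {k : ℕ} {R : Option Letter → Prog}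
    (h : Does (R (s k).head?) (Function.update s k (s k).tail) s' n) :
    Does (pop k R) s s' (n + 1) := by
  obtain ⟨t, ht, h⟩ := h
  exact ⟨1 + t, by omega, .pop h⟩

theorem loop_nil {k : ℕ} {R : Letter → Prog} (h : s k = []) : Does (loop k R) s s 1 :=
  ⟨1, le_rfl, .loop_nil h⟩

theorem loop_cons {k : ℕ} {R : Letter → Prog} {a : Letter} {l : List Letter} (hs : s k = a :: l)
    (h : Does (R a) (Function.update s k l) s' n) (h' : Does (loop k R) s' s'' n') :
    Does (loop k R) s s'' (n + n' + 1) := by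
  obtain ⟨t, ht, h⟩ := h
  obtain ⟨t', ht', h'⟩ := h'
  exact ⟨1 + t + t', by omega, .loop_cons hs h h'⟩

theorem shift (h : Does P s s' n) (x : List Letter) : Does P.shift (x ∷ₛ s) (x ∷ₛ s') n := by
  obtain ⟨t, ht, h⟩ := h
  exact ⟨t, ht, h.shift x⟩

end Does

/-- Move the contents of stack `i` to stack `j`, reversing their order. -/
def move (i j : ℕ) : Prog := loop i (push j)

/-- Move the contents of stack `i` to the stacks `j` and `k`, reversing their order. -/
def move₂ (i j k : ℕ) : Prog := loop i fun a => seq (push j a) (push k a)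

/-- Empty stack `i`. -/
def clear (i : ℕ) : Prog := loop i fun _ => skip

/-- Push the letters of a list, the last one first, so that the list ends up in front of the
contents of stack `i`. -/
def pushList (i : ℕ) (l : List Letter) : Prog := l.foldr (fun a P => seq P (push i a)) skip

theorem does_move {i j : ℕ} (hij : i ≠ j) {s s' : Store} (l : List Letter) (hl : s i = l)
    (h : Function.update (Function.update s i []) j (l.reverse ++ s j) = s') :
    Does (move i j) s s' (2 * l.length + 1) := by
  induction l generalizing s with
  | nil =>
    have : s' = s := by
      have e : Function.update s i [] = s := by rw [← hl, Function.update_eq_self]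
      rw [← h]; simp [e]
    subst this
    exact (Does.loop_nil hl).mono (by omega)
  | cons a l ih =>
    refine (Does.loop_cons hl (Does.push rfl) (ih (by simp [hij]) ?_)).mono
      (by simp only [List.length_cons]; omega)
    rw [← h]
    funext k
    by_cases hk : k = j
    · subst hk; simp [hij.symm]
    · by_cases hk' : k = i
      · subst hk'; simp [hij]
      · simp [hk, hk']

theorem does_move₂ {i j k : ℕ} (hij : i ≠ j) (hik : i ≠ k) (hjk : j ≠ k) {s s' : Store}
    (l : List Letter) (hl : s i = l)
    (h : Function.update (Function.update (Function.update s i []) j (l.reverse ++ s j)) k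
      (l.reverse ++ s k) = s') :
    Does (move₂ i j k) s s' (3 * l.length + 1) := by
  induction l generalizing s with
  | nil =>
    have : s' = s := by
      have e : Function.update s i [] = s := by rw [← hl, Function.update_eq_self]
      rw [← h]; simp [e]
    subst this
    exact (Does.loop_nil hl).mono (by omega)
  | cons a l ih =>
    refine (Does.loop_cons hl ((Does.push rfl).seq (Does.push rfl))
      (ih (by simp [hij, hik]) ?_)).mono (by simp only [List.length_cons]; omega)
    rw [← h]
    funext x
    by_cases hk : x = k
    · subst hk; simp [hik.symm, hjk.symm]
    · by_cases hk' : x = j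
      · subst hk'; simp [hij.symm, hjk]
      · by_cases hk'' : x = i
        · subst hk''; simp [hij, hik]
        · simp [hk, hk', hk'']

theorem does_clear {i : ℕ} {s s' : Store} (l : List Letter) (hl : s i = l)
    (h : Function.update s i [] = s') : Does (clear i) s s' (2 * l.length + 1) := by
  induction l generalizing s with
  | nil =>
    have : s' = s := by
      have e : Function.update s i [] = s := by rw [← hl, Function.update_eq_self]
      rw [← h]; simp [e]
    subst this
    exact (Does.loop_nil hl).mono (by omega)
  | cons a l ih =>
    exact (Does.loop_cons hl Does.skip (ih (by simp) (by simp [← h]))).mono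
      (by simp only [List.length_cons]; omega)

theorem does_pushList (i : ℕ) (l : List Letter) {s s' : Store}
    (h : Function.update s i (l ++ s i) = s') : Does (pushList i l) s s' (l.length + 1) := by
  induction l generalizing s' with
  | nil =>
    have : s' = s := by rw [← h]; simp
    subst this
    exact Does.skip.mono (by simp)
  | cons a l ih =>
    exact ((ih rfl).seq (Does.push (by simp [← h]))).mono (by simp)

end Prog

/-! ### Polynomial bounds -/

/-- A monotone function that is bounded by a polynomial. -/
def PolyBd (b : ℕ → ℕ) : Prop := Monotone b ∧ ∃ p : Polynomial ℕ, ∀ n, b n ≤ p.eval n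

namespace PolyBd

theorem const (c : ℕ) : PolyBd fun _ => c := ⟨monotone_const, Polynomial.C c, by simp⟩

theorem id : PolyBd fun n => n := ⟨monotone_id, Polynomial.X, by simp⟩

theorem add {a b : ℕ → ℕ} (ha : PolyBd a) (hb : PolyBd b) : PolyBd fun n => a n + b n := by
  obtain ⟨ma, p, hp⟩ := ha
  obtain ⟨mb, q, hq⟩ := hb
  exact ⟨ma.add mb, p + q, fun n => by simpa using add_le_add (hp n) (hq n)⟩

theorem mul {a b : ℕ → ℕ} (ha : PolyBd a) (hb : PolyBd b) : PolyBd fun n => a n * b n := by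
  obtain ⟨ma, p, hp⟩ := ha
  obtain ⟨mb, q, hq⟩ := hb
  exact ⟨fun x y h => Nat.mul_le_mul (ma h) (mb h), p * q,
    fun n => by simpa using Nat.mul_le_mul (hp n) (hq n)⟩

theorem comp {a b : ℕ → ℕ} (ha : PolyBd a) (hb : PolyBd b) : PolyBd fun n => a (b n) := by
  obtain ⟨ma, p, hp⟩ := ha
  obtain ⟨mb, q, hq⟩ := hb
  exact ⟨ma.comp mb, p.comp q, fun n => by simpa using (ma (hq n)).trans (hp _)⟩

end PolyBd

/-! ### Polynomial-time functions on binary trees -/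

/-- Binary trees, the data type of the functional layer. -/
inductive BTree : Type
  | nil
  | cons (a b : BTree)
  deriving DecidableEq

namespace BTree

/-- The number of nodes, leaves included. -/
def size : BTree → ℕ
  | nil => 1
  | cons a b => a.size + b.size + 1

/-- The prefix code of a tree. -/
def code : BTree → List Letter
  | nil => [some false]
  | cons a b => some true :: (a.code ++ b.code)

@[simp] theorem length_code (d : BTree) : d.code.length = d.size := by
  induction d with
  | nil => rfl
  | cons a b iha ihb => simp [code, size, iha, ihb]

theorem size_pos (d : BTree) : 1 ≤ d.size := by cases d <;> simp [size]

/-- The left subtree (and `nil` for `nil`). -/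
def hd : BTree → BTree
  | nil => nil
  | cons a _ => a

/-- The right subtree (and `nil` for `nil`). -/
def tl : BTree → BTree
  | nil => nil
  | cons _ b => b

theorem size_hd_le (d : BTree) : d.hd.size ≤ d.size := by
  cases d <;> simp only [hd, size] <;> omega

theorem size_tl_le (d : BTree) : d.tl.size ≤ d.size := by
  cases d <;> simp only [tl, size] <;> omega

end BTree

open BTree Prog

/-- In polynomial time a program can replace the tree `e a` by the tree `g a`, for every `a : α`:
it works on the prefix code on stack `0`, with all other stacks empty before and after. Nothing is
required of the program on trees that are not of the form `e a`. -/
def FPTree {α : Type*} (e g : α → BTree) : Prop :=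
  ∃ (P : Prog) (b : ℕ → ℕ), PolyBd b ∧ ∀ a, (g a).size ≤ b (e a).size ∧
    Does P ((e a).code ∷ₛ empty) ((g a).code ∷ₛ empty) (b (e a).size)

namespace FPTree

variable {α β : Type*} {e f g h : α → BTree}

theorem id : FPTree e e :=
  ⟨skip, fun n => n, PolyBd.id, fun d => ⟨le_rfl, Does.skip.mono (e d).size_pos⟩⟩

/-- It suffices to know a function on a larger set of inputs. -/
theorem reindex (h : FPTree e g) (r : β → α) : FPTree (fun b => e (r b)) fun b => g (r b) := by
  obtain ⟨P, b, hb, hP⟩ := h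
  exact ⟨P, b, hb, fun d => hP (r d)⟩

theorem comp (hg : FPTree f g) (hf : FPTree e f) : FPTree e g := by
  obtain ⟨P, b, hb, hP⟩ := hf
  obtain ⟨Q, c, hc, hQ⟩ := hg
  refine ⟨seq P Q, fun n => b n + c (b n), hb.add (hc.comp hb), fun d => ⟨?_, ?_⟩⟩
  · exact ((hQ _).1.trans (hc.1 (hP d).1)).trans (Nat.le_add_left _ _)
  · exact ((hP d).2.seq (hQ _).2).mono (add_le_add le_rfl (hc.1 (hP d).1))

theorem const (c : BTree) : FPTree e fun _ => c := by
  refine ⟨seq (clear 0) (pushList 0 c.code), fun n => (2 * n + 1) + (c.size + 1),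
    (((PolyBd.const 2).mul PolyBd.id).add (.const 1)).add (.const _),
    fun d => ⟨by dsimp only; omega, ?_⟩⟩
  have h1 := does_clear (i := 0) (s := (e d).code ∷ₛ empty) (e d).code rfl
    (update_push0_zero _ _ _)
  have h2 := does_pushList 0 c.code (s := [] ∷ₛ empty) (by simp; rfl)
  simpa using h1.seq h2

/-- With as many letters on stack `1` as there are trees to be read, move the prefix codes of these
trees from stack `0` to stack `2`. -/
def splitProg : Prog := loop 1 fun _ => pop 0 fun a =>
  if a = some (some true) then seq (push 2 (some true)) (seq (push 1 none) (push 1 none))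
  else push 2 (some false)

/-- Every letter `some true` read from stack `0` opens a node, which adds one to the number of trees
still to be read, and every `some false` is a leaf, which takes one away; after `a.code` the program
has therefore used up exactly one letter of stack `1`. -/
theorem does_splitProg (a : BTree) (r acc : List Letter) (c n : ℕ) {s s' : Store}
    (h : Does splitProg (r ∷ₛ List.replicate c none ∷ₛ (a.code.reverse ++ acc) ∷ₛ s) s' n) :
    Does splitProg ((a.code ++ r) ∷ₛ List.replicate (c + 1) none ∷ₛ acc ∷ₛ s) s'
      (n + 5 * a.size) := by
  induction a generalizing r acc c n with
  | nil =>
    refine (Does.loop_cons (a := none) (l := List.replicate c none) rfl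
      (.pop (.push (s' := r ∷ₛ List.replicate c none ∷ₛ ((code nil).reverse ++ acc) ∷ₛ s) ?_))
      h).mono ?_
    · simp [code]
    · simp [size]; omega
  | cons a b iha ihb =>
    have h1 := ihb r (a.code.reverse ++ some true :: acc) c n (by simpa [code] using h)
    have h2 := iha (b.code ++ r) (some true :: acc) (c + 1) _ h1
    refine (Does.loop_cons (a := none) (l := List.replicate c none) rfl
      (.pop ((Does.push rfl).seq ((Does.push rfl).seq (Does.push (s' := (a.code ++ (b.code ++ r)) ∷ₛ
        List.replicate (c + 1 + 1) none ∷ₛ (some true :: acc) ∷ₛ s) ?_)))) h2).mono ?_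
    · simp [code, List.replicate_succ]
    · simp [size]; omega

/-- With the tree `cons a b` on stack `0`, of which the first letter has been removed, move the code
of `a` to stack `2`, reversed. -/
theorem does_split (a b : BTree) :
    Does (seq (push 1 none) splitProg) ((a.code ++ b.code) ∷ₛ empty)
      (b.code ∷ₛ [] ∷ₛ a.code.reverse ∷ₛ empty) (5 * a.size + 2) := by
  refine (Does.seq (n := 1) (n' := 1 + 5 * a.size) (Does.push
    (s' := (a.code ++ b.code) ∷ₛ List.replicate 1 none ∷ₛ [] ∷ₛ empty) ?_)
    (does_splitProg a _ [] 0 1 ?_)).mono (by omega)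
  · simp
  · simpa [splitProg] using Does.loop_nil (by simp)

/-- A program for `tl`. -/
def tlProg : Prog := pop 0 fun a =>
  if a = some (some true) then seq (seq (push 1 none) splitProg) (clear 2) else push 0 (some false)

theorem does_tlProg (d : BTree) :
    Does tlProg (d.code ∷ₛ empty) (d.tl.code ∷ₛ empty) (7 * d.size + 4) := by
  cases d with
  | nil => exact (Does.pop (Does.push (by simp [code, tl]))).mono (by omega)
  | cons a b =>
    refine (Does.pop (Does.seq (by simpa [code] using does_split a b)
      (does_clear a.code.reverse (by simp) ?_))).mono ?_
    · simp [tl]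
    · simp [size]; omega

theorem tl : FPTree (fun d => d) BTree.tl :=
  ⟨tlProg, fun n => 7 * n + 4, (((PolyBd.const 7).mul .id).add (.const 4)),
    fun d => ⟨d.size_tl_le.trans (by dsimp only; omega), does_tlProg d⟩⟩

theorem hd : FPTree (fun d => d) BTree.hd := by
  refine ⟨pop 0 fun a => if a = some (some true) then
      seq (seq (push 1 none) splitProg) (seq (clear 0) (move 2 0)) else push 0 (some false),
    fun n => 7 * n + 5, (((PolyBd.const 7).mul .id).add (.const 5)),
    fun d => ⟨d.size_hd_le.trans (by dsimp only; omega), ?_⟩⟩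
  cases d with
  | nil => exact (Does.pop (Does.push (by simp [code, BTree.hd]))).mono (by dsimp only; omega)
  | cons a b =>
    refine (Does.pop (Does.seq (by simpa [code] using does_split a b)
      ((does_clear b.code (by simp) (update_push0_zero _ _ _)).seq
        (does_move (by omega) a.code.reverse (by simp) ?_)))).mono ?_
    · simp [BTree.hd]
    · simp [size]; omega

/-- The input is duplicated, and the programs for `f` and `g` are run on shifted stacks, where the
stacks below hold the data that they must not touch. -/
theorem pair (hf : FPTree e f) (hg : FPTree e g) : FPTree e fun d => .cons (f d) (g d) := by
  obtain ⟨P, b, hb, hP⟩ := hf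
  obtain ⟨Q, c, hc, hQ⟩ := hg
  refine ⟨seq (move 0 1) (seq (move₂ 1 2 3) (seq P.shift.shift.shift (seq (move 3 1)
    (seq Q.shift.shift (seq (move 2 3) (seq (move 3 0) (seq (move 1 0)
      (push 0 (some true))))))))), fun n => 5 * n + 5 * b n + 5 * c n + 8,
    (((((PolyBd.const 5).mul .id).add ((PolyBd.const 5).mul hb)).add
      ((PolyBd.const 5).mul hc)).add (.const 8)), fun d => ⟨?_, ?_⟩⟩
  · have h1 := (hP d).1
    have h2 := (hQ d).1
    simp only [size]
    omega
  have h1 : Does (move 0 1) ((e d).code ∷ₛ empty) ([] ∷ₛ (e d).code.reverse ∷ₛ empty) _ :=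
    does_move (by omega) (e d).code (by simp) (by simp)
  have h2 : Does (move₂ 1 2 3) ([] ∷ₛ (e d).code.reverse ∷ₛ empty)
      ([] ∷ₛ [] ∷ₛ (e d).code ∷ₛ (e d).code ∷ₛ empty) _ :=
    does_move₂ (by omega) (by omega) (by omega) (e d).code.reverse (by simp)
      (by simp)
  have h3 := (((hP d).2.shift (e d).code).shift []).shift []
  have h4 : Does (move 3 1) ([] ∷ₛ [] ∷ₛ (e d).code ∷ₛ (f d).code ∷ₛ empty)
      ([] ∷ₛ (f d).code.reverse ∷ₛ (e d).code ∷ₛ empty) _ :=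
    does_move (by omega) (f d).code (by simp) (by simp)
  have h5 := ((hQ d).2.shift (f d).code.reverse).shift []
  have h6 : Does (move 2 3) ([] ∷ₛ (f d).code.reverse ∷ₛ (g d).code ∷ₛ empty)
      ([] ∷ₛ (f d).code.reverse ∷ₛ [] ∷ₛ (g d).code.reverse ∷ₛ empty) _ :=
    does_move (by omega) (g d).code (by simp) (by simp)
  have h7 : Does (move 3 0) ([] ∷ₛ (f d).code.reverse ∷ₛ [] ∷ₛ (g d).code.reverse ∷ₛ empty)
      ((g d).code ∷ₛ (f d).code.reverse ∷ₛ empty) _ :=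
    does_move (by omega) (g d).code.reverse (by simp) (by simp)
  have h8 : Does (move 1 0) ((g d).code ∷ₛ (f d).code.reverse ∷ₛ empty)
      (((f d).code ++ (g d).code) ∷ₛ empty) _ :=
    does_move (by omega) (f d).code.reverse (by simp) (by simp)
  refine (h1.seq (h2.seq (h3.seq (h4.seq (h5.seq (h6.seq (h7.seq (h8.seq
    (Does.push (by simp [code]))))))))) ).mono ?_
  have h1 := (hP d).1
  have h2 := (hQ d).1
  simp only [length_code, List.length_reverse]
  omega

/-- Case distinction; each branch has to work only on the inputs that lead to it. -/
theorem cond {c : α → BTree} (hc : FPTree e c)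
    (hf : FPTree (fun a : {a // c a = .nil} => e a) fun a => f a)
    (hg : FPTree (fun a : {a // c a ≠ .nil} => e a) fun a => g a) :
    FPTree e fun a => if c a = .nil then f a else g a := by
  suffices h : FPTree (fun a => .cons (c a) (e a)) fun a => if c a = .nil then f a else g a from
    h.comp (hc.pair id)
  -- The second letter of the code of `cons (c a) (e a)` tells whether `c a` is `nil`; if so, the
  -- code of `e a` is what remains, and otherwise the two letters are put back.
  obtain ⟨P, b, hb, hP⟩ := hf
  obtain ⟨Q, b', hb', hQ⟩ := hg
  refine ⟨pop 0 fun _ => pop 0 fun a => if a = some (some true) then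
        seq (push 0 (some true)) (seq (push 0 (some true)) (seq tlProg Q))
      else P, fun n => 7 * n + b n + b' n + 8,
    (((((PolyBd.const 7).mul .id).add hb).add hb').add (.const 8)), fun d => ?_⟩
  have hle : (e d).size ≤ (BTree.cons (c d) (e d)).size := by simp only [size]; omega
  have h3 := hb.1 hle
  have h4 := hb'.1 hle
  dsimp only
  generalize hx : c d = x at *
  match x with
  | .nil =>
    obtain ⟨h1, h2⟩ := hP ⟨d, hx⟩
    simp only [if_true] at *
    refine ⟨by omega, (Does.pop (Does.pop (n := b (e d).size) ?_)).mono (by omega)⟩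
    simpa [code] using h2
  | .cons y z =>
    obtain ⟨h1, h2⟩ := hQ ⟨d, by simp [hx]⟩
    simp only [reduceCtorEq, if_false] at *
    refine ⟨by omega, (Does.pop (Does.pop (n := 1 + (1 +
      ((7 * (BTree.cons (.cons y z) (e d)).size + 4) + b' (e d).size))) ?_)).mono (by omega)⟩
    have := (Does.push (k := 0) (a := some true)
      (s := (y.code ++ z.code ++ (e d).code) ∷ₛ empty) rfl).seq ((Does.push (k := 0)
      (a := some true) (s' := (BTree.cons (.cons y z) (e d)).code ∷ₛ empty)
      (by simp [code])).seq ((does_tlProg (.cons (.cons y z) (e d))).seq h2))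
    simpa [code] using this

/-- Iterating a polynomial-time function until the left subtree is `nil`, when this takes
polynomially many steps and the intermediate results have polynomial size. -/
theorem iterate_until {i : β → α} {eβ : β → BTree} {F : α → α}
    (hF : FPTree e fun a => e (F a)) (hi : FPTree eβ fun x => e (i x)) {b : ℕ → ℕ} (hb : PolyBd b)
    (n : β → ℕ) (hn : ∀ x, n x ≤ b (eβ x).size)
    (hsize : ∀ x, ∀ j ≤ n x, (e (F^[j] (i x))).size ≤ b (eβ x).size)
    (hlt : ∀ x, ∀ j < n x, (e (F^[j] (i x))).hd ≠ .nil)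
    (hend : ∀ x, (e (F^[n x] (i x))).hd = .nil) :
    FPTree eβ fun x => e (F^[n x] (i x)) := by
  obtain ⟨P, c, hc, hP⟩ := hF
  obtain ⟨Q, b', hb', hQ⟩ := hi
  -- The loop runs as long as there is a letter on stack `1`; the body puts it back unless the first
  -- two letters on stack `0` show that the left subtree is `nil`.
  let body : Letter → Prog := fun _ => pop 0 fun a => if a = some (some true) then
      pop 0 fun a => if a = some (some true) then
        seq (push 0 (some true)) (seq (push 0 (some true)) (seq P (push 1 none)))
      else seq (push 0 (some false)) (push 0 (some true))
    else push 0 (some false)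
  have key : ∀ (k : ℕ) (d : α) (N : ℕ), (∀ i ≤ k, (e (F^[i] d)).size ≤ N) →
      (∀ i < k, (e (F^[i] d)).hd ≠ .nil) → (e (F^[k] d)).hd = .nil →
      Does (loop 1 body) ((e d).code ∷ₛ [none] ∷ₛ empty) ((e (F^[k] d)).code ∷ₛ empty)
        (k * (c N + 6) + 6) := by
    intro k
    induction k with
    | zero =>
      intro d N _ _ h
      have h0 : Does (loop 1 body) ((e d).code ∷ₛ empty) ((e d).code ∷ₛ empty) 1 := .loop_nil rfl
      refine (Does.loop_cons (n := 4) (s' := (e d).code ∷ₛ empty) (a := none) (l := []) rfl ?_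
        h0).mono (by omega)
      simp only [Function.iterate_zero, _root_.id] at h
      generalize e d = x at *
      match x, h with
      | .nil, h => exact (Does.pop (Does.push (by simp [code]))).mono (by omega)
      | .cons .nil x, h => exact Does.pop (.pop ((Does.push rfl).seq (.push (by simp [code]))))
    | succ k ih =>
      intro d N h1 h2 h3
      have h0 := ih (F d) N (fun i hi => h1 (i + 1) (by omega)) (fun i hi => h2 (i + 1) (by omega))
        h3
      have hN := hc.1 (h1 0 (by omega))
      have hd := h2 0 (by omega)
      have hPd := (hP d).2
      refine (Does.loop_cons (n := c N + 5) (a := none) (l := []) rfl ?_ h0).mono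
        (by simp only [Nat.add_mul, Nat.one_mul]; omega)
      simp only [Function.iterate_zero, _root_.id] at hd hN
      generalize e d = x at *
      match x, hd with
      | .nil, h => exact absurd rfl h
      | .cons (.cons y z) x, hd =>
        refine (Does.pop (.pop (n := 1 + (1 + (c N + 1))) ?_)).mono (by omega)
        have := (Does.push (k := 0) (a := some true)
          (s := (y.code ++ z.code ++ x.code) ∷ₛ empty) rfl).seq ((Does.push (k := 0)
          (a := some true) (s' := (BTree.cons (.cons y z) x).code ∷ₛ empty) (by simp [code])).seq
          ((hPd.mono hN).seq (Does.push (k := 1) (a := none) rfl)))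
        simpa [code] using this
  refine ⟨seq Q (seq (push 1 none) (loop 1 body)),
    fun m => b' m + (1 + (b m * (c (b m) + 6) + 6)) + b m,
    (hb'.add ((PolyBd.const 1).add ((hb.mul ((hc.comp hb).add (.const 6))).add (.const 6)))).add hb,
    fun x => ⟨(hsize x _ le_rfl).trans (Nat.le_add_left _ _), ?_⟩⟩
  refine ((hQ x).2.seq ((Does.push (s' := (e (i x)).code ∷ₛ [none] ∷ₛ empty) (by simp)).seq
    (key (n x) (i x) (b (eβ x).size) (hsize x) (hlt x) (hend x)))).mono ?_
  have := Nat.mul_le_mul_right (c (b (eβ x).size) + 6) (hn x)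
  dsimp only
  omega

end FPTree

namespace FPTree

variable {α : Type*} {e f : α → BTree}

/-- Comparison with a fixed tree; `nil` stands for equality. -/
theorem eq_const (c : BTree) (h : FPTree e f) :
    FPTree e fun a => if f a = c then .nil else .cons .nil .nil := by
  suffices H : FPTree (fun d => d) fun d => if d = c then .nil else .cons .nil .nil from
    (H.reindex f).comp h
  clear h
  induction c with
  | nil => exact cond id (const _) (const _)
  | cons x y ihx ihy =>
    have h1 := (ihx.reindex BTree.hd).comp hd
    have h2 := (ihy.reindex BTree.tl).comp tl
    have h4 := cond (f := fun d => if d.tl = y then .nil else .cons .nil .nil)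
      (g := fun _ => .cons .nil .nil) h1 (h2.reindex Subtype.val) (const _)
    have h3 := cond (e := fun d => d) (c := fun d => d) (f := fun _ => .cons .nil .nil)
      (g := fun d => if (if d.hd = x then BTree.nil else .cons .nil .nil) = .nil then
        if d.tl = y then .nil else .cons .nil .nil else .cons .nil .nil)
      id (const _) (h4.reindex Subtype.val)
    convert! h3 using 2 with d
    cases d with
    | nil => simp
    | cons a b => by_cases ha : a = x <;> by_cases hb : b = y <;> simp [BTree.hd, BTree.tl, ha, hb]

end FPTree

/-! ### Polynomial-time functions between encoded types -/

/-- Types whose elements are represented by trees. The representation need not be injective; where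
this matters, `InjEnc` is required. -/
class TreeEnc (α : Type) where
  /-- The tree that represents an element. -/
  enc : α → BTree

open TreeEnc

/-- Different elements are represented by different trees. -/
class InjEnc (α : Type) [TreeEnc α] : Prop where
  inj : Function.Injective (enc : α → BTree)

instance : TreeEnc Bool := ⟨fun b => cond b (.cons .nil .nil) .nil⟩

instance : InjEnc Bool := ⟨fun a b => by cases a <;> cases b <;> simp [enc]⟩

instance {α β : Type} [TreeEnc α] [TreeEnc β] : TreeEnc (α × β) :=
  ⟨fun p => .cons (enc p.1) (enc p.2)⟩

instance {α β : Type} [TreeEnc α] [TreeEnc β] [InjEnc α] [InjEnc β] : InjEnc (α × β) :=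
  ⟨fun a b h => by
    simp only [enc, BTree.cons.injEq] at h
    exact Prod.ext (InjEnc.inj h.1) (InjEnc.inj h.2)⟩

instance {α : Type} [TreeEnc α] : TreeEnc (Option α) :=
  ⟨fun a => a.elim .nil fun a => .cons (enc a) .nil⟩

instance {α : Type} [TreeEnc α] [InjEnc α] : InjEnc (Option α) :=
  ⟨fun a b h => by
    cases a <;> cases b <;> simp_all [enc]
    exact InjEnc.inj h⟩

instance {α : Type} [TreeEnc α] : TreeEnc (List α) := ⟨List.foldr (fun a d => .cons (enc a) d) .nil⟩

instance {α : Type} [TreeEnc α] [InjEnc α] : InjEnc (List α) :=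
  ⟨fun a b h => by
    induction a generalizing b with
    | nil => cases b <;> simp_all [enc]
    | cons x a ih =>
      cases b with
      | nil => simp [enc] at h
      | cons y b =>
        simp only [enc, List.foldr_cons, BTree.cons.injEq] at h
        rw [InjEnc.inj h.1, ih _ h.2]⟩

/-- The size of the representation of an element. -/
def sz {α : Type} [TreeEnc α] (a : α) : ℕ := (enc a).size

/-- The function `f` is computable in polynomial time with respect to the representations by
trees. -/
@[fun_prop]
def PolyFn {α β : Type} [TreeEnc α] [TreeEnc β] (f : α → β) : Prop :=
  FPTree (fun a : α => enc a) fun a => enc (f a)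

section

variable {α β γ σ κ : Type} [TreeEnc α] [TreeEnc β] [TreeEnc γ] [TreeEnc σ] [TreeEnc κ]

theorem sz_pos (a : α) : 1 ≤ sz a := size_pos _

@[simp] theorem sz_prod (p : α × β) : sz p = sz p.1 + sz p.2 + 1 := rfl

@[simp] theorem sz_nil : sz ([] : List α) = 1 := rfl

@[simp] theorem sz_cons (a : α) (l : List α) : sz (a :: l) = sz a + sz l + 1 := rfl

@[simp] theorem sz_some (a : α) : sz (some a) = sz a + 1 + 1 := rfl

theorem sz_bool_le (b : Bool) : sz b ≤ 3 := by cases b <;> decide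

theorem sz_append (l l' : List α) : sz (l ++ l') + 1 = sz l + sz l' := by
  induction l with
  | nil => simp; omega
  | cons a l ih => simp; omega

theorem length_le_sz (l : List α) : l.length ≤ sz l := by
  induction l with
  | nil => simp
  | cons a l ih => simp; omega

theorem sz_le_of_mem {l : List α} {a : α} (h : a ∈ l) : sz a ≤ sz l := by
  induction l with
  | nil => simp at h
  | cons b l ih =>
    rw [sz_cons]
    rcases List.mem_cons.1 h with rfl | h
    · omega
    · have := ih h; omega

theorem sz_tail_le (l : List α) : sz l.tail ≤ sz l := by
  cases l with
  | nil => simp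
  | cons a l => simp; omega

theorem PolyFn.sz_le {f : α → β} (hf : PolyFn f) : ∃ b, PolyBd b ∧ ∀ a, sz (f a) ≤ b (sz a) := by
  obtain ⟨P, b, hb, hP⟩ := hf
  exact ⟨b, hb, fun a => (hP a).1⟩

namespace PolyFn

@[fun_prop] theorem id : PolyFn fun a : α => a := FPTree.id

@[fun_prop] theorem const (b : β) : PolyFn fun _ : α => b := FPTree.const _

@[fun_prop] theorem comp {f : α → β} {g : β → γ} (hg : PolyFn g) (hf : PolyFn f) :
    PolyFn fun a => g (f a) := FPTree.comp (FPTree.reindex hg f) hf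

@[fun_prop] theorem pair {f : α → β} {g : α → γ} (hf : PolyFn f) (hg : PolyFn g) :
    PolyFn fun a => (f a, g a) := FPTree.pair hf hg

@[fun_prop] theorem fst {f : α → β × γ} (hf : PolyFn f) : PolyFn fun a => (f a).1 :=
  (FPTree.hd.reindex fun a => enc (f a)).comp hf

@[fun_prop] theorem snd {f : α → β × γ} (hf : PolyFn f) : PolyFn fun a => (f a).2 :=
  (FPTree.tl.reindex fun a => enc (f a)).comp hf

@[fun_prop] theorem ite {c : α → Bool} {f g : α → β} (hc : PolyFn c) (hf : PolyFn f)
    (hg : PolyFn g) : PolyFn fun a => if c a = true then f a else g a := by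
  have := FPTree.cond (f := fun a => enc (g a)) (g := fun a => enc (f a)) hc
    (FPTree.reindex hg Subtype.val) (FPTree.reindex hf Subtype.val)
  unfold PolyFn
  convert! this using 2 with a
  cases h : c a <;> simp [enc, h]

@[fun_prop] theorem list_cons {f : α → β} {g : α → List β} (hf : PolyFn f) (hg : PolyFn g) :
    PolyFn fun a => f a :: g a := FPTree.pair hf hg

/-- Case distinction according to whether a list is empty. -/
theorem list_cases {l : α → List β} {f : α → γ} {g : α → β → List β → γ} (hl : PolyFn l)
    (hf : PolyFn f) (hg : PolyFn fun p : α × β × List β => g p.1 p.2.1 p.2.2) :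
    PolyFn fun a => match l a with
      | [] => f a
      | b :: t => g a b t := by
  have hne : ∀ a : {a // enc (l a) ≠ .nil}, l a ≠ [] := by
    rintro ⟨a, ha⟩ h
    exact ha (by rw [h]; rfl)
  have h1 := FPTree.reindex hg
    (fun a : {a // enc (l a) ≠ .nil} => (a.1, (l a).head (hne a), (l a).tail))
  have h2 := FPTree.pair (FPTree.id (e := fun a => enc a)) hl
  have h3 : FPTree (fun a : {a // enc (l a) ≠ .nil} => enc a.1)
      (fun a => enc (a.1, (l a).head (hne a), (l a).tail)) := by
    convert! h2.reindex Subtype.val using 2 with a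
    conv_rhs => rw [← List.cons_head_tail (hne a)]
    rfl
  have h4 := FPTree.cond (f := fun a => enc (f a)) (g := fun a => enc (match l a with
      | [] => f a
      | b :: t => g a b t)) hl (FPTree.reindex hf Subtype.val) (by
    convert! h1.comp h3 using 2 with a
    obtain ⟨a, ha⟩ := a
    have := hne ⟨a, ha⟩
    dsimp only at this ⊢
    generalize_proofs
    revert this
    generalize l a = x
    cases x with
    | nil => simp
    | cons b t => simp)
  unfold PolyFn
  convert! h4 using 2 with a
  cases h : l a <;> simp [enc, h]

@[fun_prop] theorem tail {l : α → List β} (hl : PolyFn l) : PolyFn fun a => (l a).tail := by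
  have := list_cases (f := fun _ => []) (g := fun _ _ t => t) hl (by fun_prop) (by fun_prop)
  convert! this using 2

@[fun_prop] theorem headD {l : α → List β} {d : α → β} (hl : PolyFn l) (hd : PolyFn d) :
    PolyFn fun a => (l a).headD (d a) := by
  have := list_cases (f := d) (g := fun _ b _ => b) hl (by fun_prop) (by fun_prop)
  convert! this using 2 with a
  cases l a <;> rfl

@[fun_prop] theorem isEmpty {l : α → List β} (hl : PolyFn l) : PolyFn fun a => (l a).isEmpty := by
  have := list_cases (f := fun _ => true) (g := fun _ _ _ => false) hl (by fun_prop) (by fun_prop)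
  convert! this using 2

/-- A function that depends on a value from a finite type is computable in polynomial time if it
is so for each fixed value. -/
theorem finite_cases [Finite κ] [InjEnc κ] {k : α → κ} (hk : PolyFn k) {f : κ → α → γ}
    (hf : ∀ c, PolyFn (f c)) : PolyFn fun a => f (k a) a := by
  have key : ∀ L : List κ, FPTree (fun a : {a // k a ∈ L} => enc a.1)
      (fun a => enc (f (k a) a.1)) := by
    intro L
    induction L with
    | nil => exact ⟨.skip, fun n => n, .id, fun a => absurd a.2 (by simp)⟩
    | cons c L ih =>
      have h1 := FPTree.cond (e := fun a : {a // k a ∈ c :: L} => enc a.1)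
        (f := fun a => enc (f (k a) a.1)) (g := fun a => enc (f (k a) a.1))
        (FPTree.eq_const (enc c) (FPTree.reindex hk Subtype.val)) ?_ ?_
      · simpa using h1
      · have e : (fun a : {a : {a // k a ∈ c :: L} // (if enc (k a) = enc c then BTree.nil
            else .cons .nil .nil) = .nil} => enc (f (k a.1.1) a.1.1)) =
            fun a => enc (f c a.1.1) := by
          funext a
          have := a.2
          simp only [ite_eq_left_iff, reduceCtorEq, imp_false, not_not] at this
          rw [InjEnc.inj this]
        rw [e]
        exact FPTree.reindex (hf c) _
      · refine ih.reindex fun a : {a : {a // k a ∈ c :: L} // _} => ⟨a.1.1, ?_⟩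
        have h1 := a.2
        have h2 := a.1.2
        simp only [ne_eq, ite_eq_left_iff, reduceCtorEq, imp_false, not_not] at h1
        rcases List.mem_cons.1 h2 with h | h
        · exact absurd (congrArg enc h) h1
        · exact h
  obtain ⟨_⟩ := nonempty_fintype κ
  exact (key Finset.univ.toList).reindex fun a => ⟨a, by simp⟩

theorem of_finite [Finite κ] [InjEnc κ] (f : κ → β) : PolyFn f :=
  finite_cases (f := fun c _ => f c) id fun _ => const _

theorem comp_finite [Finite κ] [InjEnc κ] (f : κ → β) {g : α → κ} (hg : PolyFn g) :
    PolyFn fun a => f (g a) := (of_finite f).comp hg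

/-- Folding a polynomial-time function over a list, when the size of the accumulator is polynomial
in a measure `μ` that every step enlarges by an amount polynomial in the sizes of the parameter and
of the list element. -/
theorem foldl_measure {l : α → List β} {i : α → σ} {step : α → σ → β → σ} (hl : PolyFn l)
    (hi : PolyFn i) (hstep : PolyFn fun p : α × σ × β => step p.1 p.2.1 p.2.2) (μ : σ → ℕ)
    {b c m : ℕ → ℕ} (hb : PolyBd b) (hc : PolyBd c) (hm : PolyBd m) (hsz : ∀ s, sz s ≤ c (μ s))
    (hinit : ∀ a, μ (i a) ≤ m (sz a))
    (hμ : ∀ a s x, μ (step a s x) ≤ μ s + b (sz a + sz x)) :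
    PolyFn fun a => (l a).foldl (step a) (i a) := by
  -- The state of the iteration: the remaining list, the accumulator and the parameter.
  let F : List β × σ × α → List β × σ × α := fun p => match p.1 with
    | [] => p
    | x :: t => (t, step p.2.2 p.2.1 x, p.2.2)
  have hF : PolyFn F := list_cases (l := fun p : List β × σ × α => p.1) (f := fun p => p)
    (g := fun p x t => (t, step p.2.2 p.2.1 x, p.2.2)) (by fun_prop) (by fun_prop) (by
      have : PolyFn fun p : (List β × σ × α) × β × List β => (p.1.2.2, p.1.2.1, p.2.1) := by
        fun_prop
      exact ((by fun_prop : PolyFn fun p : (List β × σ × α) × β × List β => p.2.2)).pair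
        ((hstep.comp this).pair (by fun_prop)))
  have hstart : PolyFn fun a => (l a, i a, a) := by fun_prop
  have hiter : ∀ (L : List β) (s : σ) (a : α) (k : ℕ),
      F^[k] (L, s, a) = (L.drop k, (L.take k).foldl (step a) s, a) := by
    intro L s a k
    induction k generalizing L s with
    | zero => simp
    | succ k ih =>
      rw [Function.iterate_succ_apply]
      cases L with
      | nil => simpa [F] using ih [] s
      | cons x t => simpa [F] using ih t (step a s x)
  obtain ⟨bl, hbl, hl'⟩ := hl.sz_le
  have hfold : ∀ (L : List β) (s : σ) (a : α) (N : ℕ), (∀ x ∈ L, sz x ≤ N) →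
      μ (L.foldl (step a) s) ≤ μ s + L.length * b (sz a + N) := by
    intro L s a N h
    induction L generalizing s with
    | nil => simp
    | cons x t ih =>
      have h1 := ih (step a s x) fun y hy => h y (List.mem_cons_of_mem _ hy)
      have h2 := hμ a s x
      have h3 := hb.1 (Nat.add_le_add_left (h x (by simp)) (sz a))
      simp only [List.foldl_cons, List.length_cons, Nat.add_mul, Nat.one_mul]
      omega
  have hbd : ∀ (a : α) (k : ℕ), sz (F^[k] (l a, i a, a)) ≤
      bl (sz a) + c (m (sz a) + bl (sz a) * b (sz a + bl (sz a))) + sz a + 2 := by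
    intro a k
    rw [hiter]
    have h1 : sz ((l a).drop k) ≤ sz (l a) := by
      have := sz_append ((l a).take k) ((l a).drop k)
      have h := sz_pos ((l a).take k)
      rw [List.take_append_drop] at this
      omega
    have h2 := hfold ((l a).take k) (i a) a (bl (sz a)) fun x hx =>
      (sz_le_of_mem (List.mem_of_mem_take hx)).trans (hl' a)
    have h3 : ((l a).take k).length ≤ bl (sz a) :=
      (List.length_take_le' _ _).trans ((length_le_sz _).trans (hl' a))
    have h4 := Nat.mul_le_mul_right (b (sz a + bl (sz a))) h3
    have h5 := (hsz _).trans (hc.1 (h2.trans (add_le_add (hinit a) h4)))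
    have h6 := hl' a
    simp only [sz_prod]
    omega
  have hend := FPTree.iterate_until (i := fun a => (l a, i a, a)) hF hstart
    (b := fun n => bl n + c (m n + bl n * b (n + bl n)) + n + 2)
    (((hbl.add (hc.comp (hm.add (hbl.mul (hb.comp (PolyBd.id.add hbl)))))).add .id).add (.const 2))
    (fun a => (l a).length) ?_ (fun a j _ => hbd a j) ?_ ?_
  · have := PolyFn.fst (PolyFn.snd (α := α) (f := fun a => F^[(l a).length] (l a, i a, a)) hend)
    simpa [hiter] using this
  · intro a
    have := (length_le_sz (l a)).trans (hl' a)
    change _ ≤ bl (sz a) + c (m (sz a) + bl (sz a) * b (sz a + bl (sz a))) + sz a + 2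
    omega
  · intro a j hj
    rw [hiter]
    rw [List.drop_eq_getElem_cons hj]
    exact BTree.noConfusion
  · intro a
    rw [hiter]
    simp [enc, BTree.hd]

/-- The case of `foldl_measure` where the measure is the size of the accumulator. -/
theorem foldl {l : α → List β} {i : α → σ} {step : α → σ → β → σ} (hl : PolyFn l) (hi : PolyFn i)
    (hstep : PolyFn fun p : α × σ × β => step p.1 p.2.1 p.2.2) {b : ℕ → ℕ} (hb : PolyBd b)
    (hsz : ∀ a s x, sz (step a s x) ≤ sz s + b (sz a + sz x)) :
    PolyFn fun a => (l a).foldl (step a) (i a) := by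
  obtain ⟨m, hm, hi'⟩ := hi.sz_le
  exact foldl_measure hl hi hstep sz hb PolyBd.id hm (fun _ => le_rfl) hi' hsz

theorem foldl_append_reverse {β : Type*} (l : List β) (acc : List β) :
    l.foldl (fun s x => x :: s) acc = l.reverse ++ acc := by
  induction l generalizing acc with
  | nil => rfl
  | cons x l ih => simp [ih]

theorem reverseAux {l r : α → List β} (hl : PolyFn l) (hr : PolyFn r) :
    PolyFn fun a => (l a).reverse ++ r a := by
  have := foldl (step := fun _ s x => x :: s) hl hr (by fun_prop) (PolyBd.id.add (.const 1))
    (fun a s x => by simp; omega)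
  simpa only [foldl_append_reverse] using this

@[fun_prop] theorem reverse {l : α → List β} (hl : PolyFn l) : PolyFn fun a => (l a).reverse := by
  simpa using reverseAux hl (const [])

@[fun_prop] theorem append {l r : α → List β} (hl : PolyFn l) (hr : PolyFn r) :
    PolyFn fun a => l a ++ r a := by
  simpa using reverseAux hl.reverse hr

theorem foldl_map_reverse {β γ : Type*} (g : β → γ) (l : List β) (acc : List γ) :
    l.foldl (fun s x => g x :: s) acc = (l.map g).reverse ++ acc := by
  induction l generalizing acc with
  | nil => rfl
  | cons x l ih => simp [ih]

theorem map {l : α → List β} {g : α → β → γ} (hl : PolyFn l)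
    (hg : PolyFn fun p : α × β => g p.1 p.2) : PolyFn fun a => (l a).map (g a) := by
  obtain ⟨b, hb, hg'⟩ := hg.sz_le
  have h0 : PolyFn fun p : α × List γ × β => (p.1, p.2.2) := by fun_prop
  have h1 : PolyFn fun p : α × List γ × β => g p.1 p.2.2 := hg.comp h0
  have := foldl (i := fun _ => []) (step := fun a s x => g a x :: s) hl (const _)
    (h1.list_cons (by fun_prop)) ((hb.comp (PolyBd.id.add (.const 1))).add (.const 1))
    (fun a s x => by have := hg' (a, x); simp at this ⊢; omega)
  simpa only [foldl_map_reverse, List.append_nil, List.reverse_reverse] using this.reverse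

theorem any {l : α → List β} {g : α → β → Bool} (hl : PolyFn l)
    (hg : PolyFn fun p : α × β => g p.1 p.2) : PolyFn fun a => (l a).any (g a) := by
  have h0 : PolyFn fun p : α × Bool × β => (p.1, p.2.2) := by fun_prop
  have h1 : PolyFn fun p : α × Bool × β => g p.1 p.2.2 := hg.comp h0
  have := foldl (i := fun _ => false) (step := fun a s x => if g a x then true else s) hl (const _)
    (h1.ite (const _) (by fun_prop)) (PolyBd.const 3)
    (fun a s x => (sz_bool_le _).trans (Nat.le_add_left _ _))
  convert! this using 2 with a
  generalize l a = L
  have : ∀ s : Bool, (L.any (g a) || s) = L.foldl (fun s x => if g a x then true else s) s := by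
    induction L with
    | nil => simp
    | cons x t ih =>
      intro s
      rw [List.foldl_cons, ← ih, List.any_cons]
      cases g a x <;> cases s <;> simp
  simpa using this false

theorem filter {l : α → List β} {g : α → β → Bool} (hl : PolyFn l)
    (hg : PolyFn fun p : α × β => g p.1 p.2) : PolyFn fun a => (l a).filter (g a) := by
  have h0 : PolyFn fun p : α × List β × β => (p.1, p.2.2) := by fun_prop
  have h1 : PolyFn fun p : α × List β × β => g p.1 p.2.2 := hg.comp h0
  have := foldl (i := fun _ => []) (step := fun a s x => if g a x then x :: s else s) hl (const _)
    (h1.ite (by fun_prop) (by fun_prop)) (PolyBd.id.add (.const 1))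
    (fun a s x => by split <;> simp; omega)
  convert! this.reverse using 2 with a
  generalize l a = L
  have : ∀ s : List β, (L.filter (g a)).reverse ++ s =
      L.foldl (fun s x => if g a x then x :: s else s) s := by
    induction L with
    | nil => simp
    | cons x t ih =>
      intro s
      rw [List.foldl_cons, ← ih, List.filter_cons]
      cases g a x <;> simp
  rw [← this []]
  simp

@[fun_prop] theorem not {f : α → Bool} (hf : PolyFn f) : PolyFn fun a => !(f a) :=
  comp_finite _ hf

@[fun_prop] theorem and {f g : α → Bool} (hf : PolyFn f) (hg : PolyFn g) :
    PolyFn fun a => f a && g a := comp_finite (fun p : Bool × Bool => p.1 && p.2) (hf.pair hg)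

@[fun_prop] theorem or {f g : α → Bool} (hf : PolyFn f) (hg : PolyFn g) :
    PolyFn fun a => f a || g a := comp_finite (fun p : Bool × Bool => p.1 || p.2) (hf.pair hg)

theorem all {l : α → List β} {g : α → β → Bool} (hl : PolyFn l)
    (hg : PolyFn fun p : α × β => g p.1 p.2) : PolyFn fun a => (l a).all (g a) := by
  have := (any (g := fun a x => !g a x) hl hg.not).not
  convert! this using 2 with a
  generalize l a = L
  induction L <;> simp_all

theorem drop (k : ℕ) {l : α → List β} (hl : PolyFn l) : PolyFn fun a => (l a).drop k := by
  induction k generalizing l with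
  | zero => simpa using hl
  | succ k ih => simpa using ih hl.tail

theorem take (k : ℕ) {l : α → List β} (hl : PolyFn l) : PolyFn fun a => (l a).take k := by
  suffices h : PolyFn fun l : List β => l.take k from h.comp hl
  clear hl l
  induction k with
  | zero => simpa using const _
  | succ k ih =>
    have h1 : PolyFn fun p : List β × β × List β => p.2.2 := by fun_prop
    have := list_cases (f := fun _ => []) (g := fun _ b t => b :: t.take k) (id (α := List β))
      (const _) (list_cons (by fun_prop) (ih.comp h1))
    convert! this using 2 with l
    cases l <;> simp

theorem getD (k : ℕ) (d : β) {l : α → List β} (hl : PolyFn l) : PolyFn fun a => (l a).getD k d := by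
  have := headD (drop k hl) (const d)
  convert! this using 2 with a
  rw [List.headD_eq_head?_getD, List.head?_drop, List.getD_eq_getElem?_getD]

/-- Conjunctions over a fixed finite list of conditions. -/
theorem all_const {κ : Type*} (L : List κ) {g : κ → α → Bool} (hg : ∀ c ∈ L, PolyFn (g c)) :
    PolyFn fun a => L.all fun c => g c a := by
  induction L with
  | nil => simpa using const _
  | cons c L ih =>
    simp only [List.all_cons]
    exact (hg c (by simp)).and (ih fun c hc => hg c (by simp [hc]))

end PolyFn

end

/-! ### From polynomial-time functions to the class P -/

/-- Replace a string on stack `0` by the prefix code of the tree that represents it. -/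
def treeOfString : Prog := seq (move 0 1) (seq (push 0 (some false))
  (loop 1 fun a => pushList 0 (some true :: (enc a).code)))

theorem sz_letter_le (a : Letter) : sz a ≤ 5 := by
  rcases a with _ | (_ | _) <;> decide

theorem sz_string_le (x : List Letter) : sz x ≤ 6 * x.length + 1 := by
  induction x with
  | nil => simp
  | cons a x ih =>
    have := sz_letter_le a
    simp only [sz_cons, List.length_cons]
    omega

theorem does_treeOfString (x : List Letter) :
    Does treeOfString (x ∷ₛ empty) ((enc x).code ∷ₛ empty) (10 * x.length + 3) := by
  have h1 : Does (move 0 1) (x ∷ₛ empty) ([] ∷ₛ x.reverse ∷ₛ empty) _ :=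
    does_move (by omega) x (by simp) (by simp)
  have h2 : Does (push 0 (some false)) ([] ∷ₛ x.reverse ∷ₛ empty)
      ((enc ([] : List Letter)).code ∷ₛ x.reverse ∷ₛ empty) 1 := .push (by simp [code, enc])
  have h3 : ∀ l r : List Letter, Does (loop 1 fun a => pushList 0 (some true :: (enc a).code))
      ((enc r).code ∷ₛ l ∷ₛ empty) ((enc (l.reverse ++ r)).code ∷ₛ empty) (8 * l.length + 1) := by
    intro l
    induction l with
    | nil => intro r; simpa using Does.loop_nil (by simp)
    | cons a l ih =>
      intro r
      have h := ih (a :: r)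
      have ha : (enc a).size ≤ 5 := sz_letter_le a
      rw [List.reverse_cons, List.append_assoc]
      refine (Does.loop_cons (a := a) (l := l) rfl (does_pushList 0 _ ?_) h).mono ?_
      · simp [code, enc]
      · simp only [List.length_cons, length_code]; omega
  have h4 := h3 x.reverse []
  rw [List.reverse_reverse, List.append_nil] at h4
  refine (h1.seq (h2.seq h4)).mono ?_
  simp only [List.length_reverse]
  omega

/-- A language whose characteristic function is computable in polynomial time is in P. -/
theorem inP_of_polyFn {L : Set (List (Option Bool))} {f : List (Option Bool) → Bool} (hf : PolyFn f)
    (h : ∀ x, f x = true ↔ x ∈ L) : InP L := by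
  obtain ⟨P, b, hb, hP⟩ := hf
  have hbd : PolyBd fun n => 10 * n + 3 + (b (6 * n + 1) + 4) :=
    (((PolyBd.const 10).mul .id).add (.const 3)).add
      ((hb.comp (((PolyBd.const 6).mul .id).add (.const 1))).add (.const 4))
  obtain ⟨-, p, hp⟩ := hbd
  refine ⟨f, h, computable_of_run (seq treeOfString (seq P (pop 0 fun a =>
    if a = some (some true) then pop 0 fun _ => pop 0 fun _ => push 0 (some true)
    else push 0 (some false)))) p fun x => ?_⟩
  have h1 : Does (pop 0 fun a =>
      if a = some (some true) then pop 0 fun _ => pop 0 fun _ => push 0 (some true)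
      else push 0 (some false)) ((enc (f x)).code ∷ₛ empty) ([some (f x)] ∷ₛ empty) 4 := by
    cases f x
    · exact (Does.pop (Does.push (by simp [enc, code]))).mono (by omega)
    · exact Does.pop (.pop (.pop (.push (by simp [enc, code]))))
  exact ((does_treeOfString x).seq (((hP x).2.mono (hb.1 (sz_string_le x))).seq h1)).mono (hp _)

/-! ### Binary arithmetic -/

/-- The value of a binary number, least significant digit first. -/
def bitsVal (l : List Bool) : ℕ := l.foldr (fun b n => b.toNat + 2 * n) 0

@[simp] theorem bitsVal_nil : bitsVal [] = 0 := rfl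

@[simp] theorem bitsVal_cons (b : Bool) (l : List Bool) :
    bitsVal (b :: l) = b.toNat + 2 * bitsVal l := rfl

theorem bitsVal_append (l r : List Bool) :
    bitsVal (l ++ r) = bitsVal l + 2 ^ l.length * bitsVal r := by
  induction l with
  | nil => simp
  | cons b l ih => simp only [List.cons_append, bitsVal_cons, ih, List.length_cons]; ring

theorem bitsVal_headD_tail (l : List Bool) :
    (l.headD false).toNat + 2 * bitsVal l.tail = bitsVal l := by
  cases l <;> simp

theorem sz_bits_le (l : List Bool) : sz l ≤ 4 * l.length + 1 := by
  induction l with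
  | nil => simp
  | cons a x ih =>
    have := sz_bool_le a
    simp only [sz_cons, List.length_cons]
    omega

/-- One step of the addition of binary numbers, on the carry, the remaining digits of the summands,
and the digits of the sum obtained so far, the last one first. -/
def addStep (s : Bool × List Bool × List Bool × List Bool) :
    Bool × List Bool × List Bool × List Bool :=
  let a := s.2.1.headD false
  let b := s.2.2.1.headD false
  (a && b || a && s.1 || b && s.1, s.2.1.tail, s.2.2.1.tail, (a ^^ b ^^ s.1) :: s.2.2.2)

/-- Addition of binary numbers. The digits of `a ++ b` serve only to count enough steps; the result
may have superfluous zeros. -/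
def addBits (a b : List Bool) : List Bool :=
  let r := (a ++ b).foldl (fun s _ => addStep s) (false, a, b, [])
  (r.1 :: r.2.2.2).reverse

theorem bitsVal_addBits (a b : List Bool) : bitsVal (addBits a b) = bitsVal a + bitsVal b := by
  have key : ∀ (L : List Bool) (c : Bool) (a b out : List Bool), a.length ≤ L.length →
      b.length ≤ L.length →
      (fun r : Bool × List Bool × List Bool × List Bool => bitsVal (r.1 :: r.2.2.2).reverse)
        (L.foldl (fun s _ => addStep s) (c, a, b, out)) =
      bitsVal out.reverse + 2 ^ out.length * (c.toNat + bitsVal a + bitsVal b) := by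
    intro L
    induction L with
    | nil =>
      intro c a b out ha hb
      obtain rfl := List.length_eq_zero_iff.1 (Nat.le_zero.1 ha)
      obtain rfl := List.length_eq_zero_iff.1 (Nat.le_zero.1 hb)
      simp [bitsVal_append]
    | cons x L ih =>
      intro c a b out ha hb
      rw [List.foldl_cons, addStep]
      dsimp only at ih ⊢
      rw [ih _ _ _ _ (by simp at ha ⊢; omega) (by simp at hb ⊢; omega)]
      rw [← bitsVal_headD_tail a, ← bitsVal_headD_tail b]
      generalize a.headD false = p
      generalize b.headD false = q
      have : ((p ^^ q ^^ c).toNat + 2 * (p && q || p && c || q && c).toNat) =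
        p.toNat + q.toNat + c.toNat := by cases p <;> cases q <;> cases c <;> rfl
      simp only [List.reverse_cons, bitsVal_append, bitsVal_cons, bitsVal_nil, List.length_cons,
        List.length_reverse]
      rw [show c.toNat + (p.toNat + 2 * bitsVal a.tail) + (q.toNat + 2 * bitsVal b.tail) =
        (p.toNat + q.toNat + c.toNat) + 2 * bitsVal a.tail + 2 * bitsVal b.tail by ring, ← this]
      ring
  have := key (a ++ b) false a b [] (by simp) (by simp)
  simpa [addBits] using this

theorem length_addBits (a b : List Bool) : (addBits a b).length = a.length + b.length + 1 := by
  have key : ∀ (L : List Bool) (s : Bool × List Bool × List Bool × List Bool),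
      (L.foldl (fun s _ => addStep s) s).2.2.2.length = s.2.2.2.length + L.length := by
    intro L
    induction L with
    | nil => simp
    | cons x L ih => intro s; rw [List.foldl_cons, ih]; simp [addStep]; omega
  simp [addBits, key]

/-- Multiplication of binary numbers. -/
def mulBits (a b : List Bool) : List Bool :=
  a.reverse.foldl (fun s x => addBits (false :: s) (if x then b else [])) []

theorem bitsVal_mulBits (a b : List Bool) : bitsVal (mulBits a b) = bitsVal a * bitsVal b := by
  rw [mulBits, List.foldl_reverse]
  induction a with
  | nil => simp
  | cons x a ih =>
    rw [List.foldr_cons, bitsVal_addBits, bitsVal_cons, ih]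
    cases x <;> simp <;> ring

/-- Comparison of binary numbers; the digits are processed from the least significant one. -/
def leBits (a b : List Bool) : Bool :=
  ((a ++ b).foldl (fun (s : Bool × List Bool × List Bool) _ =>
    (if s.2.1.headD false ^^ s.2.2.headD false then s.2.2.headD false else s.1,
      s.2.1.tail, s.2.2.tail)) (true, a, b)).1

theorem leBits_iff (a b : List Bool) : leBits a b = true ↔ bitsVal a ≤ bitsVal b := by
  have key : ∀ (L : List Bool) (c : Bool) (a b : List Bool), a.length ≤ L.length →
      b.length ≤ L.length →
      ((L.foldl (fun (s : Bool × List Bool × List Bool) _ =>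
        (if s.2.1.headD false ^^ s.2.2.headD false then s.2.2.headD false else s.1,
          s.2.1.tail, s.2.2.tail)) (c, a, b)).1 = true ↔
      bitsVal a < bitsVal b ∨ bitsVal a = bitsVal b ∧ c = true) := by
    intro L
    induction L with
    | nil =>
      intro c a b ha hb
      obtain rfl := List.length_eq_zero_iff.1 (Nat.le_zero.1 ha)
      obtain rfl := List.length_eq_zero_iff.1 (Nat.le_zero.1 hb)
      simp
    | cons x L ih =>
      intro c a b ha hb
      rw [List.foldl_cons, ih _ _ _ (by simp at ha ⊢; omega) (by simp at hb ⊢; omega)]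
      rw [← bitsVal_headD_tail a, ← bitsVal_headD_tail b]
      dsimp only
      generalize a.headD false = p
      generalize b.headD false = q
      cases p <;> cases q <;> simp <;> omega
  rw [leBits, key (a ++ b) true a b (by simp) (by simp)]
  simp
  omega

namespace PolyFn

variable {α : Type} [TreeEnc α] {f g : α → List Bool}

theorem xor {f g : α → Bool} (hf : PolyFn f) (hg : PolyFn g) : PolyFn fun a => f a ^^ g a :=
  comp_finite (fun p : Bool × Bool => p.1 ^^ p.2) (hf.pair hg)

attribute [fun_prop] xor

theorem addStep : PolyFn addStep := by
  unfold _root_.addStep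
  dsimp only
  fun_prop

@[fun_prop] theorem addBits (hf : PolyFn f) (hg : PolyFn g) :
    PolyFn fun a => addBits (f a) (g a) := by
  have h0 : PolyFn fun a => (false, f a, g a, ([] : List Bool)) := by fun_prop
  have h1 := addStep.comp
    (by fun_prop : PolyFn fun p : α × (Bool × List Bool × List Bool × List Bool) × Bool => p.2.1)
  have := foldl (step := fun _ s _ => _root_.addStep s) (hf.append hg) h0 h1 (PolyBd.const 6)
    (fun a s x => by
      have h1 := sz_tail_le s.2.1
      have h2 := sz_tail_le s.2.2.1
      have h3 := sz_bool_le (_root_.addStep s).1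
      have h4 := sz_pos s.1
      have h5 := sz_bool_le (s.2.1.headD false ^^ s.2.2.1.headD false ^^ s.1)
      simp only [_root_.addStep, sz_prod, sz_cons] at h3 ⊢
      omega)
  unfold _root_.addBits
  dsimp only
  fun_prop

@[fun_prop] theorem mulBits (hf : PolyFn f) (hg : PolyFn g) :
    PolyFn fun a => mulBits (f a) (g a) := by
  obtain ⟨b, hb, hg'⟩ := hg.sz_le
  have h1 : PolyFn fun p : α × List Bool × Bool => g p.1 := hg.comp (by fun_prop)
  have := foldl_measure (i := fun _ => [])
    (step := fun a s x => _root_.addBits (false :: s) (if x then g a else [])) hf.reverse (const _)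
    (by fun_prop) List.length (hb.add (.const 2)) (((PolyBd.const 4).mul .id).add (.const 1))
    (PolyBd.const 0) sz_bits_le (fun _ => le_rfl) (fun a s x => by
      have h2 : (if x = true then g a else []).length ≤ b (sz a + sz x) := by
        refine le_trans ?_ ((hg' a).trans (hb.1 (Nat.le_add_right _ _)))
        split
        · exact length_le_sz _
        · simp
      rw [length_addBits, List.length_cons]
      omega)
  exact this

@[fun_prop] theorem leBits (hf : PolyFn f) (hg : PolyFn g) :
    PolyFn fun a => leBits (f a) (g a) := by
  have h0 : PolyFn fun a => (true, f a, g a) := by fun_prop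
  have := foldl (step := fun _ (s : Bool × List Bool × List Bool) _ =>
    (if s.2.1.headD false ^^ s.2.2.headD false then s.2.2.headD false else s.1,
      s.2.1.tail, s.2.2.tail)) (hf.append hg) h0 (by fun_prop) (PolyBd.const 6)
    (fun a s x => by
      have h1 := sz_tail_le s.2.1
      have h2 := sz_tail_le s.2.2
      have h3 := sz_bool_le (if s.2.1.headD false ^^ s.2.2.headD false then s.2.2.headD false
        else s.1)
      have h4 := sz_pos s.1
      simp only [sz_prod] at h3 ⊢
      omega)
  exact this.fst

end PolyFn

/-! ### Binary representation of natural numbers -/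

theorem bitsVal_encodePosNum (n : PosNum) : bitsVal (encodePosNum n) = n := by
  induction n with
  | one => rfl
  | bit0 n ih => simp [encodePosNum, ih]; ring
  | bit1 n ih => simp [encodePosNum, ih]; ring

@[simp] theorem bitsVal_encodeNat (n : ℕ) : bitsVal (encodeNat n) = n := by
  conv_rhs => rw [← Num.to_of_nat n]
  unfold encodeNat
  cases (n : Num) with
  | zero => rfl
  | pos n => simp [encodeNum, bitsVal_encodePosNum]

/-- Does a digit sequence have no superfluous zeros, that is, is it empty or does it end with the
digit `1`? -/
def normalBits (l : List Bool) : Bool := l.reverse.headD true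

theorem normalBits_encodeNat (n : ℕ) : normalBits (encodeNat n) = true := by
  unfold encodeNat
  cases (n : Num) with
  | zero => rfl
  | pos n =>
    unfold encodeNum normalBits
    dsimp only
    induction n with
    | one => rfl
    | bit0 n ih | bit1 n ih =>
      obtain ⟨x, t, h⟩ := List.exists_cons_of_ne_nil
        (show (encodePosNum n).reverse ≠ [] by simpa using encodePosNum_nonempty n)
      rw [h] at ih
      simpa [encodePosNum, h] using ih

theorem bitsVal_injOn {l r : List Bool} (hl : normalBits l = true) (hr : normalBits r = true)
    (h : bitsVal l = bitsVal r) : l = r := by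
  have zero : ∀ l : List Bool, normalBits l = true → bitsVal l = 0 → l = [] := by
    intro l hl h
    induction l using List.reverseRecOn with
    | nil => rfl
    | append_singleton l x _ =>
      simp only [normalBits, List.reverse_append, List.reverse_cons, List.reverse_nil,
        List.nil_append, List.cons_append, List.headD_cons] at hl
      simp [bitsVal_append, hl] at h
  have normal_tail : ∀ (x : Bool) (l : List Bool), normalBits (x :: l) = true →
      normalBits l = true := by
    intro x l h
    unfold normalBits at *
    rw [List.reverse_cons] at h
    cases h' : l.reverse <;> simp_all
  induction l generalizing r with
  | nil => exact (zero r hr h.symm).symm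
  | cons x l ih =>
    cases r with
    | nil => exact zero _ hl h
    | cons y r =>
      simp only [bitsVal_cons] at h
      have hxy : x = y := by cases x <;> cases y <;> simp at h ⊢ <;> omega
      subst hxy
      rw [ih (normal_tail _ _ hl) (normal_tail _ _ hr) (by omega)]

theorem encodeNat_bitsVal {l : List Bool} (hl : normalBits l = true) :
    encodeNat (bitsVal l) = l :=
  bitsVal_injOn (normalBits_encodeNat _) hl (bitsVal_encodeNat _)

@[fun_prop] theorem PolyFn.normalBits {α : Type} [TreeEnc α] {f : α → List Bool} (hf : PolyFn f) :
    PolyFn fun a => normalBits (f a) := by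
  unfold _root_.normalBits
  fun_prop

/-! ### Optimal protections and attacks are given by thresholds -/

section Thresholds

variable {n : ℕ} {T : Type} [Fintype T] [DecidableEq T]

/-- Initial segments of a set of indices have every possible size. -/
theorem exists_card_filter_lt (U : Finset (Fin n)) {r : ℕ} (hr : r ≤ U.card) :
    ∃ s : ℕ, (U.filter fun j : Fin n => (j : ℕ) < s).card = r := by
  have key : ∀ N : ℕ, r ≤ (U.filter fun j : Fin n => (j : ℕ) < N).card →
      ∃ s : ℕ, (U.filter fun j : Fin n => (j : ℕ) < s).card = r := by
    intro N
    induction N with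
    | zero => intro h; exact ⟨0, le_antisymm (by simp) h⟩
    | succ N ih =>
      intro h
      by_cases h' : r ≤ (U.filter fun j : Fin n => (j : ℕ) < N).card
      · exact ih h'
      · refine ⟨N + 1, le_antisymm ?_ h⟩
        have hsub : (U.filter fun j : Fin n => (j : ℕ) < N + 1) ⊆
            (U.filter fun j : Fin n => (j : ℕ) < N) ∪
              (Finset.univ.filter fun j : Fin n => (j : ℕ) = N) := by
          intro j
          simp only [Finset.mem_filter, Finset.mem_union, Finset.mem_univ, true_and]
          rintro ⟨hU, hj⟩
          rcases Nat.lt_succ_iff_lt_or_eq.1 hj with hj | hj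
          · exact Or.inl ⟨hU, hj⟩
          · exact Or.inr hj
        have h1 : (Finset.univ.filter fun j : Fin n => (j : ℕ) = N).card ≤ 1 :=
          Finset.card_le_one.2 fun a ha b hb => by
            simp only [Finset.mem_filter, Finset.mem_univ, true_and] at ha hb
            exact Fin.ext (ha.trans hb.symm)
        have h2 := (Finset.card_le_card hsub).trans (Finset.card_union_le _ _)
        omega
  exact key n (by rwa [Finset.filter_true_of_mem fun j _ => j.isLt])

/-- Exchanging elements for at least as good ones of the same type does not decrease the sum. -/
theorem sum_le_sum_of_exchange {ι : Type*} [DecidableEq ι] {A A' : Finset ι} {τ : ι → T}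
    {f : ι → ℤ} (hcard : ∀ t, (A.filter fun j => τ j = t).card = (A'.filter fun j => τ j = t).card)
    (hf : ∀ i ∈ A' \ A, ∀ j ∈ A \ A', τ i = τ j → f j ≤ f i) : ∑ j ∈ A, f j ≤ ∑ j ∈ A', f j := by
  have hcard' : ∀ t, ((A \ A').filter fun j => τ j = t).card =
      ((A' \ A).filter fun j => τ j = t).card := by
    intro t
    have h1 := Finset.card_inter_add_card_sdiff (A.filter fun j => τ j = t)
      (A'.filter fun j => τ j = t)
    have h2 := Finset.card_inter_add_card_sdiff (A'.filter fun j => τ j = t)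
      (A.filter fun j => τ j = t)
    have e1 : (A.filter fun j => τ j = t) \ (A'.filter fun j => τ j = t) =
        (A \ A').filter fun j => τ j = t := by ext; simp; tauto
    have e2 : (A'.filter fun j => τ j = t) \ (A.filter fun j => τ j = t) =
        (A' \ A).filter fun j => τ j = t := by ext; simp; tauto
    rw [Finset.inter_comm] at h2
    rw [e1] at h1
    rw [e2] at h2
    have := hcard t
    omega
  have h1 : ∑ j ∈ A \ A', f j ≤ ∑ j ∈ A' \ A, f j := by
    rw [← Finset.sum_fiberwise (A \ A') τ f, ← Finset.sum_fiberwise (A' \ A) τ f]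
    refine Finset.sum_le_sum fun t _ => ?_
    let e := Finset.equivOfCardEq (hcard' t)
    rw [← Finset.sum_coe_sort, ← Finset.sum_coe_sort _ f, ← Equiv.sum_comp e]
    refine Finset.sum_le_sum fun j _ => ?_
    obtain ⟨hj, hjt⟩ := Finset.mem_filter.1 j.2
    obtain ⟨hi, hit⟩ := Finset.mem_filter.1 (e j).2
    exact hf _ hi _ hj (hit.trans hjt.symm)
  rw [← Finset.sum_inter_add_sum_sdiff A A' f, ← Finset.sum_inter_add_sum_sdiff A' A f,
    Finset.inter_comm A' A]
  exact add_le_add le_rfl h1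

theorem card_eq_of_card_filter_eq {ι : Type*} {A A' : Finset ι} {τ : ι → T}
    (hcard : ∀ t, (A.filter fun j => τ j = t).card = (A'.filter fun j => τ j = t).card) :
    A.card = A'.card := by
  classical
  rw [Finset.card_eq_sum_card_fiberwise (f := τ) (t := Finset.univ) (fun _ _ => by simp),
    Finset.card_eq_sum_card_fiberwise (s := A') (f := τ) (t := Finset.univ) (fun _ _ => by simp)]
  exact Finset.sum_congr rfl fun t _ => hcard t

/-- If, among the voters of the same type, the gains `f c` of the attacker do not increase with the
index, then the defender and the attacker may restrict themselves to sets that are given by one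
threshold for each type. -/
theorem protect_iff_thresholds {C : Type*} (τ : Fin n → T) (f : C → Fin n → ℤ) (S : C → ℤ)
    (hf : ∀ c i j, τ i = τ j → i ≤ j → f c j ≤ f c i) (F B : ℕ) :
    (∃ VF : Finset (Fin n), VF.card ≤ F ∧ ∀ VB, Disjoint VB VF → VB.card ≤ B →
      ∀ c, ∑ j ∈ VB, f c j ≤ S c) ↔
    ∃ th : T → ℕ, (Finset.univ.filter fun j : Fin n => (j : ℕ) < th (τ j)).card ≤ F ∧
      ∀ th' : T → ℕ, (Finset.univ.filter fun j : Fin n =>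
          ¬ (j : ℕ) < th (τ j) ∧ (j : ℕ) < th' (τ j)).card ≤ B →
        ∀ c, ∑ j ∈ Finset.univ.filter fun j : Fin n => ¬ (j : ℕ) < th (τ j) ∧ (j : ℕ) < th' (τ j),
          f c j ≤ S c := by
  constructor
  · rintro ⟨VF, hF, h⟩
    -- Protect, of each type, as many voters as `VF` does, those of lowest index.
    have hth : ∀ t, ∃ s : ℕ, ((Finset.univ.filter fun j => τ j = t).filter
        fun j : Fin n => (j : ℕ) < s).card = (VF.filter fun j => τ j = t).card := fun t =>
      exists_card_filter_lt _ (Finset.card_le_card (Finset.filter_subset_filter _ (by simp)))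
    choose th hth using hth
    set P := Finset.univ.filter fun j : Fin n => (j : ℕ) < th (τ j) with hP
    have hPt : ∀ t, (P.filter fun j => τ j = t).card = (VF.filter fun j => τ j = t).card := by
      intro t
      rw [← hth t]
      congr 1
      ext j
      simp only [hP, Finset.mem_filter, Finset.mem_univ, true_and]
      constructor
      · rintro ⟨h1, rfl⟩; exact ⟨rfl, h1⟩
      · rintro ⟨rfl, h1⟩; exact ⟨h1, rfl⟩
    refine ⟨th, (card_eq_of_card_filter_eq hPt).trans_le hF, fun th' hB c => ?_⟩
    set A := Finset.univ.filter fun j : Fin n => ¬ (j : ℕ) < th (τ j) ∧ (j : ℕ) < th' (τ j) with hA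
    -- The protected voters of the attacked set are replaced by unprotected ones of lower index.
    have hX : ∀ t, ∃ X ⊆ (P \ VF).filter fun j => τ j = t,
        X.card = ((A ∩ VF).filter fun j => τ j = t).card := by
      intro t
      refine Finset.exists_subset_card_eq ?_
      have h1 := Finset.card_inter_add_card_sdiff (P.filter fun j => τ j = t)
        (VF.filter fun j => τ j = t)
      have h2 := Finset.card_inter_add_card_sdiff (VF.filter fun j => τ j = t)
        (P.filter fun j => τ j = t)
      rw [Finset.inter_comm] at h2
      have e1 : (P.filter fun j => τ j = t) \ (VF.filter fun j => τ j = t) =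
          (P \ VF).filter fun j => τ j = t := by ext; simp; tauto
      rw [e1] at h1
      have h3 : ((A ∩ VF).filter fun j => τ j = t).card ≤
          ((VF.filter fun j => τ j = t) \ (P.filter fun j => τ j = t)).card := by
        refine Finset.card_le_card fun j => ?_
        simp only [hA, hP, Finset.mem_filter, Finset.mem_inter, Finset.mem_sdiff, Finset.mem_univ,
          true_and]
        tauto
      have := hPt t
      omega
    choose X hXsub hXcard using hX
    let Y := Finset.univ.biUnion X
    have hY : ∀ j ∈ Y, j ∈ P ∧ j ∉ VF ∧ j ∈ X (τ j) := by
      intro j hj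
      obtain ⟨t, -, ht⟩ := Finset.mem_biUnion.1 hj
      have := hXsub t ht
      simp only [Finset.mem_filter, Finset.mem_sdiff] at this
      exact ⟨this.1.1, this.1.2, this.2 ▸ ht⟩
    have hYt : ∀ t, (Y.filter fun j => τ j = t) = X t := by
      intro t
      ext j
      simp only [Finset.mem_filter]
      constructor
      · rintro ⟨h1, rfl⟩; exact (hY j h1).2.2
      · intro hj
        exact ⟨Finset.mem_biUnion.2 ⟨t, Finset.mem_univ _, hj⟩,
          (Finset.mem_filter.1 (hXsub t hj)).2⟩
    have hPA : ∀ j ∈ P, j ∉ A := by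
      intro j
      simp only [hA, hP, Finset.mem_filter, Finset.mem_univ, true_and]
      tauto
    have hcard : ∀ t, (A.filter fun j => τ j = t).card =
        (((A \ VF) ∪ Y).filter fun j => τ j = t).card := by
      intro t
      rw [Finset.filter_union, Finset.card_union_of_disjoint, hYt, hXcard,
        ← Finset.card_inter_add_card_sdiff (A.filter fun j => τ j = t) VF, add_comm]
      · congr 2 <;> · ext; simp; tauto
      · rw [Finset.disjoint_left]
        intro j hj hj'
        simp only [Finset.mem_filter, Finset.mem_sdiff] at hj hj'
        exact hPA j (hY j hj'.1).1 hj.1.1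
    refine (sum_le_sum_of_exchange hcard ?_).trans (h ((A \ VF) ∪ Y) ?_ ?_ c)
    · intro i hi j hj hij
      simp only [Finset.mem_sdiff, Finset.mem_union] at hi hj
      have hiY : i ∈ Y := by tauto
      have hiP := (hY i hiY).1
      have hjA := hj.1
      simp only [hA, hP, Finset.mem_filter, Finset.mem_univ, true_and] at hiP hjA
      refine hf c i j hij ?_
      rw [hij] at hiP
      exact Fin.le_def.2 (by omega)
    · rw [Finset.disjoint_left]
      intro j hj
      rcases Finset.mem_union.1 hj with hj | hj
      · exact (Finset.mem_sdiff.1 hj).2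
      · exact (hY j hj).2.1
    · rwa [← card_eq_of_card_filter_eq hcard]
  · rintro ⟨th, hF, h⟩
    refine ⟨_, hF, fun VB hd hB c => ?_⟩
    have hVB : ∀ j ∈ VB, ¬ (j : ℕ) < th (τ j) := by
      intro j hj
      simpa using Finset.disjoint_left.1 hd hj
    -- The attacker may as well choose, of each type, the unprotected voters of lowest index.
    have hth : ∀ t, ∃ s : ℕ, ((Finset.univ.filter fun j : Fin n =>
        τ j = t ∧ ¬ (j : ℕ) < th t).filter fun j : Fin n => (j : ℕ) < s).card =
          (VB.filter fun j => τ j = t).card := by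
      refine fun t => exists_card_filter_lt _ (Finset.card_le_card fun j hj => ?_)
      obtain ⟨h1, rfl⟩ := Finset.mem_filter.1 hj
      simpa using hVB j h1
    choose th' hth' using hth
    have hcard : ∀ t, (VB.filter fun j => τ j = t).card = ((Finset.univ.filter fun j : Fin n =>
        ¬ (j : ℕ) < th (τ j) ∧ (j : ℕ) < th' (τ j)).filter fun j => τ j = t).card := by
      intro t
      rw [← hth' t]
      congr 1
      ext j
      simp only [Finset.mem_filter, Finset.mem_univ, true_and]
      constructor
      · rintro ⟨⟨rfl, h1⟩, h2⟩; exact ⟨⟨h1, h2⟩, rfl⟩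
      · rintro ⟨⟨h1, h2⟩, rfl⟩; exact ⟨⟨rfl, h1⟩, h2⟩
    refine (sum_le_sum_of_exchange hcard ?_).trans
      (h th' ((card_eq_of_card_filter_eq hcard).symm.trans_le hB) c)
    intro i hi j hj hij
    refine hf c i j hij (Fin.le_def.2 ?_)
    simp only [Finset.mem_sdiff, Finset.mem_filter, Finset.mem_univ, true_and, not_and,
      not_lt] at hi hj
    have h1 := hj.2 (not_lt.1 (hVB j hj.1))
    rw [hij] at hi
    omega

end Thresholds

/-! ### Reduction of attacks to gains -/

section Gain

variable {m : ℕ} {ι κ : Type} [Fintype ι] [DecidableEq ι] [Fintype κ] [DecidableEq κ]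

/-- The game between the defender and the attacker with unit prices, for voters indexed by an
arbitrary type. -/
def UnitProtectable (α : Fin (m + 1) → ℕ) (w : ι → ℕ) (τ : ι → Equiv.Perm (Fin (m + 1)))
    (F B : ℕ) : Prop :=
  ∃ VF : Finset ι, VF.card ≤ F ∧ ∀ VB : Finset ι, Disjoint VB VF → VB.card ≤ B →
    ∀ τ' : ι → Equiv.Perm (Fin (m + 1)), ∀ c, c ≠ Fin.last m →
      ∑ j, w j * α ((if j ∈ VB then τ' j else τ j).symm c) ≤
        ∑ j, w j * α ((if j ∈ VB then τ' j else τ j).symm (Fin.last m))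

/-- The game does not depend on the order of the voters. -/
theorem unitProtectable_congr {α : Fin (m + 1) → ℕ} {w : ι → ℕ}
    {τ : ι → Equiv.Perm (Fin (m + 1))} {w' : κ → ℕ} {σ : κ → Equiv.Perm (Fin (m + 1))} (e : ι ≃ κ)
    (hw : ∀ j, w' (e j) = w j) (hτ : ∀ j, σ (e j) = τ j) {F B : ℕ}
    (h : UnitProtectable α w τ F B) : UnitProtectable α w' σ F B := by
  obtain ⟨VF, hF, h⟩ := h
  refine ⟨VF.map e.toEmbedding, by simpa using hF, fun VB hd hB τ' c hc => ?_⟩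
  have := h (VB.map e.symm.toEmbedding) ?_ (by simpa using hB) (fun j => τ' (e j)) c hc
  · rw [← Equiv.sum_comp e, ← Equiv.sum_comp e]
    simpa [hw, hτ] using this
  · rw [Finset.disjoint_left] at hd ⊢
    intro j hj hj'
    refine hd (a := e j) ?_ ?_
    · obtain ⟨k, hk, rfl⟩ := Finset.mem_map.1 hj
      simpa using hk
    · simpa using hj'

/-- The amount, per unit of weight, by which bribing a voter with preference list `t` can change the
difference between the scores of `c` and of the last candidate. -/
def gain (α : Fin (m + 1) → ℕ) (c : Fin (m + 1)) (t : Equiv.Perm (Fin (m + 1))) : ℤ :=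
  (α 0 - α (Fin.last m)) - (α (t.symm c) - α (t.symm (Fin.last m)))

theorem gain_nonneg {α : Fin (m + 1) → ℕ} (hα : Antitone α) (c : Fin (m + 1))
    (t : Equiv.Perm (Fin (m + 1))) : 0 ≤ gain α c t := by
  have h1 := hα (Fin.zero_le (t.symm c))
  have h2 := hα (Fin.le_last (t.symm (Fin.last m)))
  unfold gain
  omega

/-- A preference list with `c` on top and the last candidate at the bottom. -/
theorem exists_best_list {c : Fin (m + 1)} (hc : c ≠ Fin.last m) :
    ∃ t : Equiv.Perm (Fin (m + 1)), t.symm c = 0 ∧ t.symm (Fin.last m) = Fin.last m := by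
  have h0 : (0 : Fin (m + 1)) ≠ Fin.last m := by
    rintro h
    apply hc
    have hm : m = 0 := by simpa [Fin.ext_iff] using h.symm
    subst hm
    exact Fin.ext (by have := c.isLt; omega)
  exact ⟨(Equiv.swap c 0).symm, by simp, by
    simpa using Equiv.swap_apply_of_ne_of_ne hc.symm h0.symm⟩

/-- Bribing the voters in `VB` in the best way for `c` does not make `c` beat the last candidate if
and only if the gains do not exceed the lead of the last candidate. -/
theorem sum_le_iff_gain (α : Fin (m + 1) → ℕ) (w : ι → ℕ) (τ : ι → Equiv.Perm (Fin (m + 1)))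
    (VB : Finset ι) (c : Fin (m + 1)) :
    ∑ j, w j * α (if j ∈ VB then 0 else (τ j).symm c) ≤
      ∑ j, w j * α (if j ∈ VB then Fin.last m else (τ j).symm (Fin.last m)) ↔
    ∑ j ∈ VB, w j * gain α c (τ j) ≤
      ∑ j, (w j : ℤ) * (α ((τ j).symm (Fin.last m)) - α ((τ j).symm c)) := by
  rw [← Finset.sum_filter_add_sum_filter_not Finset.univ (· ∈ VB) fun j =>
    (w j : ℤ) * (α ((τ j).symm (Fin.last m)) - α ((τ j).symm c))]
  zify
  rw [← Finset.sum_filter_add_sum_filter_not Finset.univ (· ∈ VB) fun j =>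
      (w j : ℤ) * α (if j ∈ VB then 0 else (τ j).symm c),
    ← Finset.sum_filter_add_sum_filter_not Finset.univ (· ∈ VB) fun j =>
      (w j : ℤ) * α (if j ∈ VB then Fin.last m else (τ j).symm (Fin.last m))]
  have e : Finset.univ.filter (· ∈ VB) = VB := by ext; simp
  have e1 : ∀ x y : ι → Fin (m + 1), ∑ j with j ∈ VB, (w j : ℤ) * α (if j ∈ VB then x j else y j) =
      ∑ j ∈ VB, (w j : ℤ) * α (x j) := by
    intro x y
    rw [e]
    exact Finset.sum_congr rfl fun j hj => by rw [if_pos hj]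
  have e2 : ∀ x y : ι → Fin (m + 1), ∑ j with j ∉ VB, (w j : ℤ) * α (if j ∈ VB then x j else y j) =
      ∑ j with j ∉ VB, (w j : ℤ) * α (y j) := by
    intro x y
    exact Finset.sum_congr rfl fun j hj => by rw [if_neg (by simpa using hj)]
  rw [e1, e1, e2, e2, e]
  simp only [gain, mul_sub, Finset.sum_sub_distrib]
  constructor <;> intro h <;> linarith

theorem unitProtectable_iff_gain {α : Fin (m + 1) → ℕ} (hα : Antitone α) (w : ι → ℕ)
    (τ : ι → Equiv.Perm (Fin (m + 1))) (F B : ℕ) :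
    UnitProtectable α w τ F B ↔
      ∃ VF : Finset ι, VF.card ≤ F ∧ ∀ VB : Finset ι, Disjoint VB VF → VB.card ≤ B →
        ∀ c : {c // c ≠ Fin.last m}, ∑ j ∈ VB, w j * gain α c (τ j) ≤
          ∑ j, (w j : ℤ) * (α ((τ j).symm (Fin.last m)) - α ((τ j).symm c)) := by
  refine exists_congr fun VF => and_congr_right fun _ => forall_congr' fun VB =>
    forall_congr' fun _ => forall_congr' fun _ => ?_
  constructor
  · rintro h ⟨c, hc⟩
    obtain ⟨t, ht0, htl⟩ := exists_best_list hc
    rw [← sum_le_iff_gain]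
    convert! h (fun _ => t) c hc using 4 with j _ j _
    · split_ifs <;> simp [ht0]
    · split_ifs <;> simp [htl]
  · intro h τ' c hc
    have h1 := (sum_le_iff_gain α w τ VB c).2 (h ⟨c, hc⟩)
    refine (Finset.sum_le_sum fun j _ => Nat.mul_le_mul_left _ ?_).trans
      (h1.trans (Finset.sum_le_sum fun j _ => Nat.mul_le_mul_left _ ?_))
    · split_ifs
      · exact hα (Fin.zero_le _)
      · exact le_rfl
    · split_ifs
      · exact hα (Fin.le_last _)
      · exact le_rfl

/-- For voters sorted by weight, the heaviest one first, the defender and the attacker may restrict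
themselves to sets given by one threshold for each preference list, and the attacker may put the
candidate that is to win on top of the new lists and the last candidate at the bottom. -/
theorem unitProtectable_iff_thresholds {n : ℕ} {α : Fin (m + 1) → ℕ} (hα : Antitone α)
    {w : Fin n → ℕ} (hw : Antitone w) (τ : Fin n → Equiv.Perm (Fin (m + 1))) (F B : ℕ) :
    UnitProtectable α w τ F B ↔ ∃ th : Equiv.Perm (Fin (m + 1)) → ℕ,
      (Finset.univ.filter fun j : Fin n => (j : ℕ) < th (τ j)).card ≤ F ∧
      ∀ th' : Equiv.Perm (Fin (m + 1)) → ℕ, (Finset.univ.filter fun j : Fin n =>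
          ¬ (j : ℕ) < th (τ j) ∧ (j : ℕ) < th' (τ j)).card ≤ B → ∀ c ≠ Fin.last m,
        ∑ j, w j * α (if ¬ (j : ℕ) < th (τ j) ∧ (j : ℕ) < th' (τ j) then 0 else (τ j).symm c) ≤
        ∑ j, w j * α (if ¬ (j : ℕ) < th (τ j) ∧ (j : ℕ) < th' (τ j) then Fin.last m
          else (τ j).symm (Fin.last m)) := by
  rw [unitProtectable_iff_gain hα, protect_iff_thresholds (T := Equiv.Perm (Fin (m + 1))) τ
    (fun (c : {c // c ≠ Fin.last m}) j => w j * gain α c (τ j))]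
  · refine exists_congr fun th => and_congr_right fun _ => forall_congr' fun th' =>
      forall_congr' fun _ => ?_
    rw [Subtype.forall]
    refine forall_congr' fun c => forall_congr' fun _ => ?_
    rw [← sum_le_iff_gain]
    simp
  · intro c i j hij hle
    rw [hij]
    exact mul_le_mul_of_nonneg_right (by exact_mod_cast hw hle) (gain_nonneg hα _ _)

theorem Election.destructivelyProtectable_iff (E : Election (m + 1)) (F B : ℕ) :
    E.DestructivelyProtectable (fun _ => 1) (fun _ => 1) F B ↔
      UnitProtectable E.rule.score E.weight E.pref F B := by
  simp only [Election.DestructivelyProtectable, UnitProtectable, Finset.sum_const, smul_eq_mul,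
    mul_one, not_lt, Election.totalScore, Election.bribe]

end Gain

/-! ### More polynomial-time functions -/

section

variable {α β γ κ : Type} [TreeEnc α] [TreeEnc β] [TreeEnc γ] [TreeEnc κ]

theorem exists_sz_le (κ : Type) [TreeEnc κ] [Finite κ] : ∃ K, ∀ k : κ, sz k ≤ K := by
  obtain ⟨_⟩ := nonempty_fintype κ
  exact ⟨Finset.univ.sup sz, fun k => Finset.le_sup (f := sz) (Finset.mem_univ k)⟩

theorem sz_reverse (l : List α) : sz l.reverse = sz l := by
  induction l with
  | nil => rfl
  | cons a l ih =>
    have := sz_append l.reverse [a]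
    simp only [List.reverse_cons, sz_cons, sz_nil] at this ⊢
    omega

theorem sz_drop_le (k : ℕ) (l : List α) : sz (l.drop k) ≤ sz l := by
  induction k generalizing l with
  | zero => simp
  | succ k ih =>
    cases l with
    | nil => simp
    | cons a l => have := ih l; simp; omega

namespace PolyFn

theorem eq_const [DecidableEq β] [InjEnc β] (c : β) {f : α → β} (hf : PolyFn f) :
    PolyFn fun a => decide (f a = c) := by
  have h : PolyFn fun a => !decide (f a = c) := by
    have := FPTree.eq_const (enc c) hf
    unfold PolyFn
    convert! this using 2 with a
    by_cases h : f a = c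
    · simp [h, enc]
    · have h' : enc (f a) ≠ enc c := fun h' => h (InjEnc.inj h')
      simp only [h, h', decide_false, Bool.not_false, if_false]
      rfl
  simpa using h.not

/-- Searching through the end segments of a list, as many as it has elements, is the way in which
thresholds are searched for. -/
theorem tails_any {l : α → List β} {g : α → List β → Bool} (hl : PolyFn l)
    (hg : PolyFn fun p : α × List β => g p.1 p.2) : PolyFn fun a => (l a).tails.any (g a) := by
  have h0 : PolyFn fun p : α × (List β × Bool) × β => g p.1 p.2.1.1 :=
    hg.comp (by fun_prop : PolyFn fun p : α × (List β × Bool) × β => (p.1, p.2.1.1))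
  have h1 := foldl (i := fun a => (l a, false))
    (step := fun a (s : List β × Bool) _ => (s.1.tail, g a s.1 || s.2)) hl (by fun_prop)
    (by fun_prop) (PolyBd.const 3) (fun a s x => by
      have h1 := sz_tail_le s.1
      have h2 := sz_bool_le (g a s.1 || s.2)
      have h3 := sz_pos s.2
      simp only [sz_prod]
      omega)
  have h2 := (hg.comp (pair id (const []))).or h1.snd
  convert! h2 using 2 with a
  have key : ∀ (L : List β) (b : Bool), (L.tails.any (g a) || b) = (g a [] ||
      (L.foldl (fun (s : List β × Bool) _ => (s.1.tail, g a s.1 || s.2)) (L, b)).2) := by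
    intro L
    induction L with
    | nil => simp
    | cons x L ih =>
      intro b
      rw [List.foldl_cons, List.tail_cons, ← ih]
      simp only [List.tails_cons, List.any_cons]
      cases g a (x :: L) <;> simp
  simpa using key (l a) false

end PolyFn

/-- The sum of the binary numbers `f x` over the elements `x` of a list. -/
def sumBits {β : Type} (f : β → List Bool) (l : List β) : List Bool :=
  l.foldl (fun s x => addBits s (f x)) []

theorem bitsVal_sumBits {β : Type} (f : β → List Bool) (l : List β) :
    bitsVal (sumBits f l) = (l.map fun x => bitsVal (f x)).sum := by
  have key : ∀ s, bitsVal (l.foldl (fun s x => addBits s (f x)) s) =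
      bitsVal s + (l.map fun x => bitsVal (f x)).sum := by
    induction l with
    | nil => simp
    | cons x l ih => intro s; simp [ih, bitsVal_addBits, add_assoc]
  simpa [sumBits] using key []

theorem PolyFn.sumBits {l : α → List β} {f : α → β → List Bool} (hl : PolyFn l)
    (hf : PolyFn fun p : α × β => f p.1 p.2) : PolyFn fun a => sumBits (f a) (l a) := by
  obtain ⟨b, hb, hf'⟩ := hf.sz_le
  have h1 : PolyFn fun p : α × List Bool × β => f p.1 p.2.2 :=
    hf.comp (by fun_prop : PolyFn fun p : α × List Bool × β => (p.1, p.2.2))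
  exact foldl_measure (i := fun _ => []) (step := fun a s x => _root_.addBits s (f a x)) hl
    (const _) (by fun_prop) List.length ((hb.comp (PolyBd.id.add (.const 1))).add (.const 1))
    (((PolyBd.const 4).mul .id).add (.const 1)) (PolyBd.const 0) sz_bits_le (fun _ => le_rfl)
    (fun a s x => by
      have h2 : (f a x).length ≤ b (sz a + sz x + 1) := (length_le_sz _).trans (hf' (a, x))
      rw [length_addBits]
      omega)

end

/-! ### Voters as data -/

/-- Preference lists of `m + 1` candidates. -/
abbrev Pref (m : ℕ) : Type := Equiv.Perm (Fin (m + 1))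

/-- A preference list is represented in unary by its number in some enumeration. Any injective
representation would do, since there are only finitely many preference lists. -/
noncomputable instance (m : ℕ) : TreeEnc (Pref m) :=
  ⟨fun τ => enc (List.replicate (Fintype.equivFin (Pref m) τ) false)⟩

instance (m : ℕ) : InjEnc (Pref m) :=
  ⟨fun a b h => by
    have h1 := congrArg List.length (InjEnc.inj (α := List Bool) h)
    simp only [List.length_replicate] at h1
    exact (Fintype.equivFin (Pref m)).injective (Fin.ext h1)⟩

/-- A voter in the search: the weight in binary, the preference list, and the status, where
`some false` stands for protected and `some true` for bribed. -/
abbrev Rec (m : ℕ) : Type := List Bool × Pref m × Option Bool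

/-- All preference lists, in some order. -/
noncomputable def allPrefs (m : ℕ) : List (Pref m) := Finset.univ.toList

variable {m : ℕ}

/-- Give the status `q` to those among the first `k.length` voters that have the preference list
`t` and no status. -/
def mark (q : Bool) (t : Pref m) (k s : List (Rec m)) : List (Rec m) :=
  (s.foldl (fun (p : List (Rec m) × List (Rec m)) v => (p.1.tail, (v.1, v.2.1,
    if !p.1.isEmpty && (decide (v.2.1 = t) && v.2.2.isNone) then some q else v.2.2) :: p.2))
    (k, [])).2.reverse

/-- Is there a way to mark voters with `q`, in accordance with one threshold for each of the given
preference lists, such that `p` holds? A threshold is represented by an end segment `k` of the list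
of voters, of which only the length matters. -/
def search (q : Bool) : List (Pref m) → (List (Rec m) → Bool) → List (Rec m) → Bool
  | [], p, s => p s
  | t :: ts, p, s => s.tails.any fun k => search q ts p (mark q t k s)

/-- The binary number of voters with status `q`. -/
def countBits (q : Bool) (s : List (Rec m)) : List Bool :=
  sumBits (fun v => if v.2.2 = some q then [true] else []) s

/-- The total score of a candidate whose position in the list of a voter is given by `pos`. -/
def scoreBits (pos : Pref m × Option Bool → Fin (m + 1)) (a : List (List Bool))
    (s : List (Rec m)) : List Bool :=
  sumBits (fun v => mulBits v.1 (a.getD (pos v.2) [])) s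

/-- The position of candidate `c` when the bribed voters put it on top. -/
def topPos (c : Fin (m + 1)) (x : Pref m × Option Bool) : Fin (m + 1) :=
  if x.2 = some true then 0 else x.1.symm c

/-- The position of the last candidate when the bribed voters put it at the bottom. -/
def bottomPos (x : Pref m × Option Bool) : Fin (m + 1) :=
  if x.2 = some true then Fin.last m else x.1.symm (Fin.last m)

/-- No candidate gets a higher score than the last one when the bribed voters help it as much as
possible. -/
noncomputable def noneBeats (a : List (List Bool)) (s : List (Rec m)) : Bool :=
  (Finset.univ.filter (· ≠ Fin.last m)).toList.all fun c =>
    leBits (scoreBits (topPos c) a s) (scoreBits bottomPos a s)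

/-- Sort voters by weight, the heaviest first. -/
def sortVoters (l : List (List Bool × Pref m)) : List (List Bool × Pref m) :=
  l.foldl (fun s v => s.filter (fun u => leBits v.1 u.1) ++
    v :: s.filter fun u => !leBits v.1 u.1) []

/-- The data of an instance: scores, defense budget, attack budget, voters. -/
abbrev InstanceData (m : ℕ) : Type :=
  List (List Bool) × List Bool × List Bool × List (List Bool × Pref m)

/-- The exhaustive search that decides the protection problem. -/
noncomputable def decideData (d : InstanceData m) : Bool :=
  let s : List (Rec m) := (sortVoters d.2.2.2).map fun v => (v.1, v.2, none)
  noneBeats d.1 s && search false (allPrefs m) (fun s => leBits (countBits false s) d.2.1 &&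
    !search true (allPrefs m) (fun s => leBits (countBits true s) d.2.2.1 && !noneBeats d.1 s) s) s

namespace PolyFn

variable {α : Type} [TreeEnc α]

theorem mark (q : Bool) (t : Pref m) {k s : α → List (Rec m)} (hk : PolyFn k) (hs : PolyFn s) :
    PolyFn fun a => mark q t (k a) (s a) := by
  obtain ⟨K, hK⟩ := exists_sz_le (Option Bool)
  have h1 : PolyFn fun p : α × (List (Rec m) × List (Rec m)) × Rec m =>
      (decide (p.2.2.2.1 = t) && p.2.2.2.2.isNone) :=
    comp_finite (fun x : Pref m × Option Bool => decide (x.1 = t) && x.2.isNone) (by fun_prop)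
  have h2 := foldl (i := fun a => (k a, [])) (step := fun _ (p : List (Rec m) × List (Rec m)) v =>
    (p.1.tail, (v.1, v.2.1, if !p.1.isEmpty && (decide (v.2.1 = t) && v.2.2.isNone) then some q
      else v.2.2) :: p.2)) hs (by fun_prop) (by fun_prop) (PolyBd.id.add (.const (K + 3)))
    (fun a p v => by
      have h1 := sz_tail_le p.1
      have h2 := hK (if !p.1.isEmpty && (decide (v.2.1 = t) && v.2.2.isNone) then some q
        else v.2.2)
      simp only [sz_prod, sz_cons] at h2 ⊢
      omega)
  exact h2.snd.reverse

theorem search (q : Bool) (ts : List (Pref m)) {g : α → List (Rec m) → Bool}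
    (hg : PolyFn fun p : α × List (Rec m) => g p.1 p.2) :
    PolyFn fun p : α × List (Rec m) => search q ts (g p.1) p.2 := by
  induction ts with
  | nil => exact hg
  | cons t ts ih =>
    have h1 : PolyFn fun p : (α × List (Rec m)) × List (Rec m) => _root_.mark q t p.2 p.1.2 :=
      mark q t (by fun_prop) (by fun_prop)
    have h2 : PolyFn fun p : (α × List (Rec m)) × List (Rec m) =>
        (p.1.1, _root_.mark q t p.2 p.1.2) := by fun_prop
    exact tails_any (g := fun (p : α × List (Rec m)) k =>
        _root_.search q ts (g p.1) (_root_.mark q t k p.2))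
      (by fun_prop) (ih.comp h2)

@[fun_prop] theorem countBits (q : Bool) {s : α → List (Rec m)} (hs : PolyFn s) :
    PolyFn fun a => countBits q (s a) :=
  sumBits (f := fun _ (v : Rec m) => if v.2.2 = some q then [true] else []) hs
    (comp_finite (fun x : Option Bool => if x = some q then [true] else []) (by fun_prop))

theorem scoreBits (pos : Pref m × Option Bool → Fin (m + 1)) {r : α → List (List Bool)}
    {s : α → List (Rec m)} (hr : PolyFn r) (hs : PolyFn s) :
    PolyFn fun a => scoreBits pos (r a) (s a) := by
  have h1 : PolyFn fun p : α × Rec m => (r p.1).getD (pos p.2.2) [] :=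
    finite_cases (k := fun p : α × Rec m => p.2.2)
      (f := fun c p => (r p.1).getD (pos c) []) (by fun_prop) fun c => getD _ _ (by fun_prop)
  exact sumBits (f := fun a (v : Rec m) => _root_.mulBits v.1 ((r a).getD (pos v.2) [])) hs
    (by fun_prop)

@[fun_prop] theorem noneBeats {r : α → List (List Bool)} {s : α → List (Rec m)} (hr : PolyFn r)
    (hs : PolyFn s) : PolyFn fun a => noneBeats (r a) (s a) :=
  all_const (g := fun c a => _root_.leBits (_root_.scoreBits (topPos c) (r a) (s a))
    (_root_.scoreBits bottomPos (r a) (s a))) _ fun c _ =>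
      (scoreBits (topPos c) hr hs).leBits (scoreBits bottomPos hr hs)

theorem sortVoters {l : α → List (List Bool × Pref m)} (hl : PolyFn l) :
    PolyFn fun a => sortVoters (l a) := by
  have h0 : PolyFn fun p : (α × List (List Bool × Pref m) × (List Bool × Pref m)) ×
    (List Bool × Pref m) => _root_.leBits p.1.2.2.1 p.2.1 := by fun_prop
  have h1 : PolyFn fun p : α × List (List Bool × Pref m) × (List Bool × Pref m) =>
      p.2.1.filter fun u => _root_.leBits p.2.2.1 u.1 :=
    filter (g := fun (p : α × List (List Bool × Pref m) × (List Bool × Pref m))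
      (u : List Bool × Pref m) => _root_.leBits p.2.2.1 u.1) (by fun_prop) h0
  have h2 : PolyFn fun p : α × List (List Bool × Pref m) × (List Bool × Pref m) =>
      p.2.1.filter fun u => !_root_.leBits p.2.2.1 u.1 :=
    filter (g := fun (p : α × List (List Bool × Pref m) × (List Bool × Pref m))
      (u : List Bool × Pref m) => !_root_.leBits p.2.2.1 u.1) (by fun_prop) h0.not
  refine foldl (i := fun _ => []) (step := fun _ s v => s.filter (fun u => _root_.leBits v.1 u.1) ++
    v :: s.filter fun u => !_root_.leBits v.1 u.1) hl (const _) (by fun_prop)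
    (PolyBd.id.add (.const 1)) fun a s v => ?_
  have h3 := sz_append (s.filter fun u => _root_.leBits v.1 u.1)
    (v :: s.filter fun u => !_root_.leBits v.1 u.1)
  have h4 : ∀ s : List (List Bool × Pref m), sz (s.filter fun u => _root_.leBits v.1 u.1) +
      sz (s.filter fun u => !_root_.leBits v.1 u.1) = sz s + 1 := by
    intro s
    induction s with
    | nil => rfl
    | cons u s ih =>
      simp only [List.filter_cons]
      cases _root_.leBits v.1 u.1 <;> simp <;> omega
  have h5 := h4 s
  rw [sz_cons] at h3
  omega

theorem decideData {d : α → InstanceData m} (hd : PolyFn d) :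
    PolyFn fun a => decideData (d a) := by
  suffices h : PolyFn fun d : InstanceData m => _root_.decideData d from h.comp hd
  have h0 : PolyFn fun d : InstanceData m => (_root_.sortVoters d.2.2.2).map
      fun v => ((v.1, v.2, none) : Rec m) :=
    map (g := fun _ v => ((v.1, v.2, none) : Rec m)) (sortVoters (by fun_prop)) (by fun_prop)
  have h1 : PolyFn fun p : InstanceData m × List (Rec m) => _root_.search true (allPrefs m)
      (fun s => _root_.leBits (_root_.countBits true s) p.1.2.2.1 &&
        !_root_.noneBeats p.1.1 s) p.2 :=
    search true (allPrefs m) (g := fun (d : InstanceData m) s =>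
      _root_.leBits (_root_.countBits true s) d.2.2.1 && !_root_.noneBeats d.1 s) (by fun_prop)
  have h2 := search false (allPrefs m) (g := fun (d : InstanceData m) s =>
    _root_.leBits (_root_.countBits false s) d.2.1 && !_root_.search true (allPrefs m)
      (fun s => _root_.leBits (_root_.countBits true s) d.2.2.1 && !_root_.noneBeats d.1 s) s)
    (by fun_prop)
  have h3 := h2.comp (id.pair h0)
  unfold _root_.decideData
  dsimp only
  fun_prop

end PolyFn

/-! ### Parsing the input -/

/-- One step of cutting a string at the separators: the digits read since the last separator and
the finished numbers, both in reverse order. -/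
def splitStep (p : List Bool × List (List Bool)) (a : Letter) : List Bool × List (List Bool) :=
  a.elim ([], p.1.reverse :: p.2) fun b => (b :: p.1, p.2)

theorem splitStep_digits (w : List Bool) (p : List Bool × List (List Bool)) :
    (w.map some).foldl splitStep p = (w.reverse ++ p.1, p.2) := by
  induction w generalizing p with
  | nil => rfl
  | cons b w ih => simp [ih, splitStep]

theorem splitStep_join (l out : List (List Bool)) :
    (l.flatMap fun w => w.map some ++ [none]).foldl splitStep ([], out) =
      ([], l.reverse ++ out) := by
  induction l generalizing out with
  | nil => rfl
  | cons w l ih => simp [splitStep_digits, splitStep, ih]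

theorem join_splitStep (x : List Letter) (p : List Bool × List (List Bool)) :
    ((x.foldl splitStep p).2.reverse.flatMap fun w => w.map some ++ [none]) ++
      (x.foldl splitStep p).1.reverse.map some =
    (p.2.reverse.flatMap fun w => w.map some ++ [none]) ++ p.1.reverse.map some ++ x := by
  induction x generalizing p with
  | nil => simp
  | cons a x ih =>
    rw [List.foldl_cons, ih]
    cases a <;> simp [splitStep]

section

variable {m : ℕ}

/-- A preference list as a sequence of binary numbers. -/
def prefCode (t : Pref m) : List (List Bool) := List.ofFn fun i => encodeNat (t i : ℕ)

@[simp] theorem length_prefCode (t : Pref m) : (prefCode t).length = m + 1 := by simp [prefCode]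

theorem prefCode_injective : Function.Injective (prefCode (m := m)) := by
  intro s t h
  have h1 := List.ofFn_injective h
  ext i
  have h2 := congrArg bitsVal (congrFun h1 i)
  simpa using h2

/-- The first of the preference lists `ts` that has the code `l`, and the identity if there is
none. -/
def lookupPref : List (Pref m) → List (List Bool) → Pref m
  | [], _ => 1
  | t :: ts, l => if decide (l = prefCode t) then t else lookupPref ts l

/-- Is `l` the code of a preference list? -/
noncomputable def isPrefCode (l : List (List Bool)) : Bool :=
  !(allPrefs m).all fun t => !decide (l = prefCode t)

theorem isPrefCode_iff (l : List (List Bool)) :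
    isPrefCode (m := m) l = true ↔ ∃ t : Pref m, l = prefCode t := by
  simp [isPrefCode, allPrefs]

theorem lookupPref_prefCode (t : Pref m) : lookupPref (allPrefs m) (prefCode t) = t := by
  have key : ∀ ts : List (Pref m), t ∈ ts → lookupPref ts (prefCode t) = t := by
    intro ts
    induction ts with
    | nil => simp
    | cons u ts ih =>
      intro h
      by_cases hu : prefCode t = prefCode u
      · simp [lookupPref, prefCode_injective hu]
      · rcases List.mem_cons.1 h with rfl | h
        · exact absurd rfl hu
        · simp [lookupPref, hu, ih h]
  exact key _ (by simp [allPrefs])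

/-- One step of reading voters: the numbers that are still to be read, whether all voters have been
well-formed, and the voters obtained so far, the last one first. -/
noncomputable def voterStep (p : List (List Bool) × Bool × List (List Bool × Pref m)) :
    List (List Bool) × Bool × List (List Bool × Pref m) :=
  if p.1.isEmpty then p else (p.1.drop (m + 2),
    p.2.1 && (!(p.1.headD []).isEmpty && isPrefCode (m := m) (p.1.tail.take (m + 1))),
    (p.1.headD [], lookupPref (allPrefs m) (p.1.tail.take (m + 1))) :: p.2.2)

/-- The numbers that describe a sequence of voters. -/
def voterCodes (vs : List (List Bool × Pref m)) : List (List Bool) :=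
  vs.flatMap fun v => v.1 :: prefCode v.2

/-- Reading voters, for as many steps as there are elements of `L`. -/
noncomputable def readVoters (L : List (List Bool))
    (p : List (List Bool) × Bool × List (List Bool × Pref m)) :
    List (List Bool) × Bool × List (List Bool × Pref m) :=
  L.foldl (fun p _ => voterStep p) p

theorem readVoters_nil (L : List (List Bool)) (b : Bool) (out : List (List Bool × Pref m)) :
    readVoters L ([], b, out) = ([], b, out) := by
  induction L with
  | nil => rfl
  | cons x L ih => exact ih

theorem readVoters_false (L : List (List Bool)) (l : List (List Bool))
    (out : List (List Bool × Pref m)) : (readVoters L (l, false, out)).2.1 = false := by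
  induction L generalizing l out with
  | nil => rfl
  | cons x L ih =>
    change (readVoters L (voterStep (l, false, out))).2.1 = false
    unfold voterStep
    split
    · exact ih _ _
    · exact ih _ _

theorem readVoters_voterCodes (vs : List (List Bool × Pref m)) (hvs : ∀ v ∈ vs, v.1 ≠ [])
    (L : List (List Bool)) (hL : vs.length ≤ L.length) (out : List (List Bool × Pref m)) :
    readVoters L (voterCodes vs, true, out) = ([], true, vs.reverse ++ out) := by
  induction vs generalizing L out with
  | nil => exact readVoters_nil _ _ _
  | cons v vs ih =>
    cases L with
    | nil => simp at hL
    | cons x L =>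
      have h1 : voterStep (voterCodes (v :: vs), true, out) =
          (voterCodes vs, true, v :: out) := by
        have e : voterCodes (v :: vs) = v.1 :: (prefCode v.2 ++ voterCodes vs) := by
          simp [voterCodes]
        have e1 : (prefCode v.2 ++ voterCodes vs).take (m + 1) = prefCode v.2 := by
          rw [List.take_append_of_le_length (by simp)]
          exact List.take_of_length_le (by simp)
        have e2 : (prefCode v.2 ++ voterCodes vs).drop (m + 1) = voterCodes vs :=
          List.drop_left' (by simp)
        have h2 : isPrefCode (m := m) (prefCode v.2) = true := (isPrefCode_iff _).2 ⟨_, rfl⟩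
        have h3 : v.1.isEmpty = false := by simpa using hvs v (by simp)
        simp [voterStep, e, e1, e2, h2, h3, lookupPref_prefCode]
      change readVoters L (voterStep (voterCodes (v :: vs), true, out)) = _
      rw [h1, ih (fun u hu => hvs u (by simp [hu])) L (by simpa using hL)]
      simp

theorem exists_voters_of_readVoters (L l : List (List Bool)) (hL : l.length ≤ L.length)
    (out : List (List Bool × Pref m)) (h : (readVoters L (l, true, out)).2.1 = true) :
    ∃ vs : List (List Bool × Pref m), (∀ v ∈ vs, v.1 ≠ []) ∧ l = voterCodes vs := by
  induction L generalizing l out with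
  | nil =>
    obtain rfl := List.length_eq_zero_iff.1 (Nat.le_zero.1 hL)
    exact ⟨[], by simp, rfl⟩
  | cons x L ih =>
    cases l with
    | nil => exact ⟨[], by simp, rfl⟩
    | cons w l =>
      change (readVoters L (voterStep (w :: l, true, out))).2.1 = true at h
      simp only [voterStep, List.isEmpty_cons, Bool.false_eq_true, if_false, List.drop_succ_cons,
        List.headD_cons, List.tail_cons, Bool.true_and] at h
      cases hb : !w.isEmpty && isPrefCode (m := m) (l.take (m + 1)) with
      | false => simp [hb, readVoters_false] at h
      | true =>
        rw [hb] at h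
        simp only [Bool.and_eq_true, Bool.not_eq_true', isPrefCode_iff] at hb
        obtain ⟨hw, t, ht⟩ := hb
        obtain ⟨vs, hvs, hl⟩ := ih _ (by simp at hL ⊢; omega) _ h
        refine ⟨(w, t) :: vs, ?_, ?_⟩
        · intro v hv
          rcases List.mem_cons.1 hv with rfl | hv
          · simpa using hw
          · exact hvs v hv
        · rw [← List.take_append_drop (m + 1) l, hl, ht]
          simp [voterCodes]

/-- The data of the instance that a sequence of binary numbers describes, and whether there is such
an instance. -/
noncomputable def readInstance (l : List (List Bool)) : Bool × InstanceData m :=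
  let p : List (List Bool) × Bool × List (List Bool × Pref m) :=
    readVoters (l.drop (m + 3)) (l.drop (m + 3), true, [])
  (!(l.drop (m + 2)).isEmpty && (l.all normalBits && (p.2.1 &&
      (List.finRange m).all fun i => leBits (l.getD (i + 1) []) (l.getD i []))),
    l.take (m + 1), l.getD (m + 1) [], l.getD (m + 2) [], p.2.2.reverse)

/-- The data of the instance that a string describes, and whether there is such an instance. -/
noncomputable def parse (x : List Letter) : Bool × InstanceData m :=
  let p := x.foldl splitStep ([], [])
  let r : Bool × InstanceData m := readInstance p.2.reverse
  (p.1.isEmpty && r.1, r.2)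

/-- The data of an instance. -/
def WeightedProtectionInstance.data (I : WeightedProtectionInstance (m + 1)) : InstanceData m :=
  (List.ofFn fun i => encodeNat (I.rule.score i), encodeNat I.defenseBudget,
    encodeNat I.attackBudget, I.voters.map fun v => (encodeNat v.weight, v.pref))

theorem map_encodeNat_toNats (I : WeightedProtectionInstance (m + 1)) :
    I.toNats.map encodeNat = I.data.1 ++ (I.data.2.1 :: I.data.2.2.1 ::
      voterCodes I.data.2.2.2) := by
  simp [WeightedProtectionInstance.toNats, WeightedProtectionInstance.data, voterCodes,
    List.map_flatMap, List.flatMap_map, List.map_ofFn, prefCode, Function.comp_def]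

theorem encodeNats_eq (l : List ℕ) :
    encodeNats l = (l.map encodeNat).flatMap fun w => w.map some ++ [none] := by
  simp [encodeNats, List.flatMap_map]

theorem encodeNat_ne_nil {n : ℕ} (h : 0 < n) : encodeNat n ≠ [] := by
  intro h'
  have := bitsVal_encodeNat n
  rw [h', bitsVal_nil] at this
  omega

/-- The string of an instance is recognized, and its data are found. -/
theorem parse_encode (I : WeightedProtectionInstance (m + 1)) :
    parse I.encode = (true, I.data) := by
  rw [WeightedProtectionInstance.encode, encodeNats_eq]
  have h0 := map_encodeNat_toNats I
  have hnorm : (I.toNats.map encodeNat).all normalBits = true := by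
    simp [normalBits_encodeNat]
  rw [h0] at hnorm ⊢
  have hlen : I.data.1.length = m + 1 := by simp [WeightedProtectionInstance.data]
  have hsc : ∀ i : Fin (m + 1), I.data.1.getD i [] = encodeNat (I.rule.score i) := by
    intro i
    have hi : (i : ℕ) ≤ m := by omega
    simp [WeightedProtectionInstance.data, -List.ofFn_succ, hi]
  generalize hS : I.data.1 = S at *
  generalize hR : voterCodes I.data.2.2.2 = R at *
  have e2 : (S ++ (I.data.2.1 :: I.data.2.2.1 :: R)).drop (m + 2) = I.data.2.2.1 :: R := by
    rw [List.drop_append, hlen, List.drop_of_length_le (by omega)]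
    simp
  have e3 : (S ++ (I.data.2.1 :: I.data.2.2.1 :: R)).drop (m + 3) = R := by
    rw [List.drop_append, hlen, List.drop_of_length_le (by omega)]
    simp
  have e4 : (S ++ (I.data.2.1 :: I.data.2.2.1 :: R)).take (m + 1) = S := List.take_left' hlen
  have e5 : (S ++ (I.data.2.1 :: I.data.2.2.1 :: R)).getD (m + 1) [] = I.data.2.1 := by
    rw [List.getD_append_right _ _ _ _ (by omega)]
    simp [hlen]
  have e6 : (S ++ (I.data.2.1 :: I.data.2.2.1 :: R)).getD (m + 2) [] = I.data.2.2.1 := by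
    rw [List.getD_append_right _ _ _ _ (by omega)]
    simp [hlen]
  have e7 : ∀ i : Fin (m + 1), (S ++ (I.data.2.1 :: I.data.2.2.1 :: R)).getD i [] =
      encodeNat (I.rule.score i) := by
    intro i
    rw [List.getD_append _ _ _ _ (by omega), hsc]
  have hv : readVoters R (R, true, []) = ([], true, I.data.2.2.2.reverse) := by
    have := readVoters_voterCodes I.data.2.2.2 ?_ R ?_ []
    · rwa [hR, List.append_nil] at this
    · intro v hv
      simp only [WeightedProtectionInstance.data, List.mem_map] at hv
      obtain ⟨u, -, rfl⟩ := hv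
      exact encodeNat_ne_nil u.weight_pos
    · rw [← hR, voterCodes, List.length_flatMap]
      simp
      nlinarith
  have hanti : ((List.finRange m).all fun i : Fin m =>
      leBits ((S ++ (I.data.2.1 :: I.data.2.2.1 :: R)).getD (i + 1) [])
        ((S ++ (I.data.2.1 :: I.data.2.2.1 :: R)).getD i [])) = true := by
    rw [List.all_eq_true]
    intro i _
    have h1 := e7 i.succ
    have h2 := e7 i.castSucc
    simp only [Fin.val_succ, Fin.val_castSucc] at h1 h2
    rw [h1, h2, leBits_iff, bitsVal_encodeNat, bitsVal_encodeNat]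
    exact I.rule.antitone_score (Fin.castSucc_lt_succ).le
  rw [parse, splitStep_join]
  simp only [List.append_nil, List.reverse_reverse, readInstance, e2, e3, e4, e5, e6, hnorm, hv,
    hanti]
  simp [← hS]

/-- Only the strings of instances are recognized. -/
theorem exists_instance_of_parse (x : List Letter)
    (h : (parse x : Bool × InstanceData m).1 = true) :
    ∃ I : WeightedProtectionInstance (m + 1), I.encode = x := by
  have hx := join_splitStep x ([], [])
  simp only [parse, readInstance, Bool.and_eq_true, List.isEmpty_iff, Bool.not_eq_true',
    List.isEmpty_eq_false_iff] at h
  obtain ⟨h0, hlen, hnorm, hvot, hanti⟩ := h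
  rw [h0] at hx
  simp only [List.reverse_nil, List.map_nil, List.append_nil, List.flatMap_nil,
    List.nil_append] at hx
  generalize (x.foldl splitStep ([], [])).2.reverse = l at *
  obtain ⟨vs, hvs, hdrop⟩ := exists_voters_of_readVoters _ _ le_rfl _ hvot
  have hlen' : m + 2 < l.length := by
    rw [ne_eq, List.drop_eq_nil_iff] at hlen
    omega
  rw [List.all_eq_true] at hnorm hanti
  have hV : ∀ vs : List (List Bool × Pref m), (∀ v ∈ vs, v.1 ≠ [] ∧ normalBits v.1 = true) →
      ∃ V : List (Voter (m + 1)), V.map (fun v => (encodeNat v.weight, v.pref)) = vs := by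
    intro vs
    induction vs with
    | nil => exact fun _ => ⟨[], rfl⟩
    | cons v vs ih =>
      intro h
      obtain ⟨V, hV⟩ := ih fun u hu => h u (by simp [hu])
      obtain ⟨h1, h2⟩ := h v (by simp)
      refine ⟨⟨bitsVal v.1, Nat.pos_of_ne_zero fun h0 => h1 ?_, v.2⟩ :: V, ?_⟩
      · exact bitsVal_injOn h2 rfl h0
      · simp [hV, encodeNat_bitsVal h2]
  obtain ⟨V, hV⟩ := hV vs fun v hv => ⟨hvs v hv, hnorm _ (List.mem_of_mem_drop (i := m + 3) (by
    rw [hdrop, voterCodes, List.mem_flatMap]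
    exact ⟨v, hv, by simp⟩))⟩
  have hget : ∀ i, i < l.length → encodeNat (bitsVal (l.getD i [])) = l.getD i [] := by
    intro i hi
    rw [List.getD_eq_getElem _ _ hi]
    exact encodeNat_bitsVal (hnorm _ (List.getElem_mem hi))
  refine ⟨⟨⟨⟨fun i => bitsVal (l.getD i []), ?_⟩, V⟩, bitsVal (l.getD (m + 1) []),
    bitsVal (l.getD (m + 2) [])⟩, ?_⟩
  · rw [Fin.antitone_iff_succ_le]
    intro i
    have := hanti i (List.mem_finRange i)
    rwa [leBits_iff] at this
  · rw [WeightedProtectionInstance.encode, encodeNats_eq, map_encodeNat_toNats]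
    have h1 : (List.ofFn fun i : Fin (m + 1) => encodeNat (bitsVal (l.getD i []))) =
        l.take (m + 1) := by
      refine List.ext_getElem (by simp; omega) fun i hi hi' => ?_
      have hi2 : i < l.length := by simp at hi; omega
      rw [List.getElem_ofFn, List.getElem_take, hget _ hi2, List.getD_eq_getElem _ _ hi2]
    simp only [WeightedProtectionInstance.data, hV]
    rw [h1, hget _ (by omega), hget _ (by omega), ← hdrop, List.getD_eq_getElem _ _ (by omega),
      List.getD_eq_getElem _ _ hlen', ← List.drop_eq_getElem_cons,
      ← List.drop_eq_getElem_cons, List.take_append_drop]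
    exact hx

end

namespace PolyFn

variable {m : ℕ} {α : Type} [TreeEnc α]

theorem splitStep : PolyFn fun p : (List Bool × List (List Bool)) × Letter =>
    splitStep p.1 p.2 :=
  finite_cases (k := fun p : (List Bool × List (List Bool)) × Letter => p.2)
    (f := fun a p => _root_.splitStep p.1 a) (by fun_prop) fun a => by
      cases a
      · exact ((const []).pair (by fun_prop))
      · exact ((list_cons (const _) (by fun_prop)).pair (by fun_prop))

theorem split {x : α → List Letter} (hx : PolyFn x) :
    PolyFn fun a => (x a).foldl _root_.splitStep ([], []) :=
  foldl (i := fun _ => ([], [])) (step := fun _ p a => _root_.splitStep p a) hx (const _)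
    (splitStep.comp (by fun_prop :
      PolyFn fun p : α × (List Bool × List (List Bool)) × Letter => p.2)) (PolyBd.id.add (.const 2))
    fun a p c => by
      cases c <;> simp [_root_.splitStep, sz_reverse] <;> omega

theorem lookupPref (ts : List (Pref m)) {l : α → List (List Bool)} (hl : PolyFn l) :
    PolyFn fun a => lookupPref ts (l a) := by
  induction ts with
  | nil => exact const _
  | cons t ts ih => exact ite (eq_const (prefCode t) hl) (const t) ih

theorem isPrefCode {l : α → List (List Bool)} (hl : PolyFn l) :
    PolyFn fun a => isPrefCode (m := m) (l a) :=
  (all_const (g := fun t a => !decide (l a = prefCode t)) _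
    fun t _ => (eq_const (prefCode t) hl).not).not

theorem voterStep : PolyFn (voterStep (m := m)) := by
  have h1 : PolyFn fun p : List (List Bool) × Bool × List (List Bool × Pref m) =>
      p.1.tail.take (m + 1) := take _ (by fun_prop)
  have h2 := lookupPref (allPrefs m) h1
  have h3 := isPrefCode (m := m) h1
  have h4 : PolyFn fun p : List (List Bool) × Bool × List (List Bool × Pref m) =>
      p.1.drop (m + 2) := drop _ (by fun_prop)
  unfold _root_.voterStep
  fun_prop

theorem readVoters {l : α → List (List Bool)} (hl : PolyFn l) :
    PolyFn fun a => readVoters (m := m) (l a) (l a, true, []) := by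
  obtain ⟨K, hK⟩ := exists_sz_le (Pref m)
  refine foldl (i := fun a => (l a, true, [])) (step := fun _ p _ => _root_.voterStep (m := m) p) hl
    (by fun_prop) (voterStep.comp (by fun_prop)) (PolyBd.const (K + 6)) fun a p c => ?_
  obtain ⟨l, b, out⟩ := p
  cases l with
  | nil => simp [_root_.voterStep]
  | cons w l =>
    have h1 := hK (_root_.lookupPref (allPrefs m) (l.take (m + 1)))
    have h2 := sz_bool_le (b && (!w.isEmpty && _root_.isPrefCode (m := m) (l.take (m + 1))))
    have h3 := sz_drop_le (m + 1) l
    have h4 := sz_pos b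
    simp only [_root_.voterStep, List.isEmpty_cons, Bool.false_eq_true, if_false,
      List.drop_succ_cons, List.headD_cons, List.tail_cons, sz_prod, sz_cons] at h1 h2 ⊢
    omega

theorem readInstance {l : α → List (List Bool)} (hl : PolyFn l) :
    PolyFn fun a => readInstance (m := m) (l a) := by
  have h1 := drop (m + 2) hl
  have h2 := readVoters (m := m) (drop (m + 3) hl)
  have h3 : PolyFn fun a => (l a).all _root_.normalBits :=
    all (g := fun _ w => _root_.normalBits w) hl (by fun_prop)
  have h4 : PolyFn fun a => (List.finRange m).all
      fun i : Fin m => _root_.leBits ((l a).getD (i + 1) []) ((l a).getD i []) :=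
    all_const (g := fun (i : Fin m) a => _root_.leBits ((l a).getD (i + 1) []) ((l a).getD i [])) _
      fun i _ => (getD ((i : ℕ) + 1) [] hl).leBits (getD (i : ℕ) [] hl)
  have h5 := take (m + 1) hl
  have h6 := getD (m + 1) [] hl
  have h7 := getD (m + 2) [] hl
  unfold _root_.readInstance
  dsimp only
  fun_prop

theorem parse : PolyFn (parse (m := m)) := by
  have h1 := split (id (α := List Letter))
  have h2 := readInstance (m := m) (h1.snd.reverse)
  unfold _root_.parse
  dsimp only
  fun_prop

end PolyFn

/-! ### Correctness of the search -/

section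

variable {m : ℕ}

theorem mark_eq_mapIdx (q : Bool) (t : Pref m) (k s : List (Rec m)) :
    mark q t k s = s.mapIdx fun i v => (v.1, v.2.1,
      if i < k.length ∧ v.2.1 = t ∧ v.2.2 = none then some q else v.2.2) := by
  have key : ∀ out, (s.foldl (fun (p : List (Rec m) × List (Rec m)) v => (p.1.tail, (v.1, v.2.1,
      if !p.1.isEmpty && (decide (v.2.1 = t) && v.2.2.isNone) then some q else v.2.2) :: p.2))
      (k, out)).2 = (s.mapIdx fun i v => ((v.1, v.2.1,
        if i < k.length ∧ v.2.1 = t ∧ v.2.2 = none then some q else v.2.2) : Rec m)).reverse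
          ++ out := by
    induction s generalizing k with
    | nil => simp
    | cons v s ih =>
      intro out
      rw [List.foldl_cons, ih, List.mapIdx_cons]
      have h : (!k.isEmpty && (decide (v.2.1 = t) && v.2.2.isNone)) = true ↔
          0 < k.length ∧ v.2.1 = t ∧ v.2.2 = none := by
        cases k <;> simp
      simp only [h, List.length_tail, Nat.lt_sub_iff_add_lt, List.reverse_cons, List.append_assoc,
        List.singleton_append]
  rw [mark, key]
  simp

/-- The search runs through all families of thresholds. -/
theorem search_iff (q : Bool) {ts : List (Pref m)} (hts : ts.Nodup) (p : List (Rec m) → Bool)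
    (s : List (Rec m)) : search q ts p s = true ↔
      ∃ th : Pref m → ℕ, p (s.mapIdx fun i v => (v.1, v.2.1,
        if v.2.1 ∈ ts ∧ i < th v.2.1 ∧ v.2.2 = none then some q else v.2.2)) = true := by
  induction ts generalizing s with
  | nil =>
    have : (s.mapIdx fun _ v => v) = s := by
      apply List.ext_getElem <;> simp
    simp [search, this]
  | cons t ts ih =>
    obtain ⟨ht, hts⟩ := List.nodup_cons.1 hts
    -- Marking the voters of type `t` first and then those of the types in `ts` amounts to marking
    -- all of them at once.
    have key : ∀ (k : List (Rec m)) (th th' : Pref m → ℕ),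
        (∀ i < s.length, i < th' t ↔ i < k.length) → (∀ u ∈ ts, th' u = th u) →
        ((mark q t k s).mapIdx fun i v => ((v.1, v.2.1,
          if v.2.1 ∈ ts ∧ i < th v.2.1 ∧ v.2.2 = none then some q else v.2.2) : Rec m)) =
        s.mapIdx fun i v => (v.1, v.2.1,
          if v.2.1 ∈ t :: ts ∧ i < th' v.2.1 ∧ v.2.2 = none then some q else v.2.2) := by
      intro k th th' h1 h2
      rw [mark_eq_mapIdx]
      refine List.ext_getElem (by simp) fun i hi _ => ?_
      have hi' : i < s.length := by simpa [mark_eq_mapIdx] using hi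
      simp only [List.getElem_mapIdx, Prod.mk.injEq, true_and, List.mem_cons]
      by_cases hv : s[i].2.1 = t
      · simp [hv, ht, h1 i hi']
      · by_cases hv' : s[i].2.1 ∈ ts
        · simp [hv, hv', h2 _ hv']
        · simp [hv, hv']
    simp only [search, List.any_eq_true, List.mem_tails, ih hts]
    constructor
    · rintro ⟨k, -, th, h⟩
      refine ⟨Function.update th t k.length, ?_⟩
      rwa [← key k th _ (by simp) fun u hu =>
        Function.update_of_ne (by rintro rfl; exact ht hu) _ _]
    · rintro ⟨th, h⟩
      refine ⟨s.drop (s.length - th t), List.drop_suffix _ _, th, ?_⟩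
      rwa [key _ th th (fun i hi => by rw [List.length_drop]; omega) fun _ _ => rfl]

/-- The voters `j : Fin n` with weights `w j`, preference lists `τ j` and status `st j`. -/
def recs {n : ℕ} (w : Fin n → List Bool) (τ : Fin n → Pref m) (st : Fin n → Option Bool) :
    List (Rec m) :=
  List.ofFn fun j => (w j, τ j, st j)

theorem search_recs {n : ℕ} (q : Bool) (p : List (Rec m) → Bool) (w : Fin n → List Bool)
    (τ : Fin n → Pref m) (st : Fin n → Option Bool) :
    search q (allPrefs m) p (recs w τ st) = true ↔ ∃ th : Pref m → ℕ,
      p (recs w τ fun j => if (j : ℕ) < th (τ j) ∧ st j = none then some q else st j) = true := by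
  rw [search_iff (ts := allPrefs m) q (Finset.nodup_toList _)]
  refine exists_congr fun th => ?_
  suffices h : ((recs w τ st).mapIdx fun i v => ((v.1, v.2.1,
      if v.2.1 ∈ allPrefs m ∧ i < th v.2.1 ∧ v.2.2 = none then some q else v.2.2) : Rec m)) =
      recs w τ fun j => if (j : ℕ) < th (τ j) ∧ st j = none then some q else st j by rw [h]
  apply List.ext_getElem <;> simp [recs, allPrefs]

theorem search_recs_protect {n : ℕ} (p : List (Rec m) → Bool) (w : Fin n → List Bool)
    (τ : Fin n → Pref m) : search false (allPrefs m) p (recs w τ fun _ => none) = true ↔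
      ∃ th : Pref m → ℕ,
        p (recs w τ fun j => if (j : ℕ) < th (τ j) then some false else none) = true := by
  rw [search_recs]
  refine exists_congr fun th =>
    (congrArg (fun st => p (recs w τ st) = true) (funext fun j => ?_)).to_iff
  simp

theorem search_recs_bribe {n : ℕ} (p : List (Rec m) → Bool) (w : Fin n → List Bool)
    (τ : Fin n → Pref m) (th : Pref m → ℕ) :
    search true (allPrefs m) p
        (recs w τ fun j => if (j : ℕ) < th (τ j) then some false else none) = true ↔
      ∃ th' : Pref m → ℕ, p (recs w τ fun j => if (j : ℕ) < th (τ j) then some false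
        else if (j : ℕ) < th' (τ j) then some true else none) = true := by
  rw [search_recs]
  refine exists_congr fun th' =>
    (congrArg (fun st => p (recs w τ st) = true) (funext fun j => ?_)).to_iff
  by_cases h : (j : ℕ) < th (τ j) <;> simp [h]

theorem bitsVal_countBits_recs {n : ℕ} (q : Bool) (w : Fin n → List Bool) (τ : Fin n → Pref m)
    (st : Fin n → Option Bool) : bitsVal (countBits q (recs w τ st)) =
      (Finset.univ.filter fun j => st j = some q).card := by
  rw [countBits, bitsVal_sumBits, recs, List.map_ofFn, List.sum_ofFn, Finset.card_filter]
  refine Finset.sum_congr rfl fun j _ => ?_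
  by_cases h : st j = some q <;> simp [h, bitsVal]

theorem bitsVal_scoreBits_recs {n : ℕ} (pos : Pref m × Option Bool → Fin (m + 1))
    (α : Fin (m + 1) → ℕ) (w : Fin n → List Bool) (τ : Fin n → Pref m)
    (st : Fin n → Option Bool) :
    bitsVal (scoreBits pos (List.ofFn fun i => encodeNat (α i)) (recs w τ st)) =
      ∑ j, bitsVal (w j) * α (pos (τ j, st j)) := by
  rw [scoreBits, bitsVal_sumBits, recs, List.map_ofFn, List.sum_ofFn]
  refine Finset.sum_congr rfl fun j _ => ?_
  have hp : (pos (τ j, st j) : ℕ) ≤ m := by omega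
  simp [bitsVal_mulBits, -List.ofFn_succ, hp]

theorem noneBeats_recs {n : ℕ} (α : Fin (m + 1) → ℕ) (w : Fin n → List Bool) (τ : Fin n → Pref m)
    (st : Fin n → Option Bool) :
    noneBeats (List.ofFn fun i => encodeNat (α i)) (recs w τ st) = true ↔ ∀ c ≠ Fin.last m,
      ∑ j, bitsVal (w j) * α (if st j = some true then 0 else (τ j).symm c) ≤
      ∑ j, bitsVal (w j) * α (if st j = some true then Fin.last m
        else (τ j).symm (Fin.last m)) := by
  simp only [noneBeats, List.all_eq_true, Finset.mem_toList, Finset.mem_filter, Finset.mem_univ,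
    true_and, leBits_iff, bitsVal_scoreBits_recs, topPos, bottomPos]

theorem sortVoters_perm (l : List (List Bool × Pref m)) : (sortVoters l).Perm l := by
  have key : ∀ s, (l.foldl (fun s v => s.filter (fun u => leBits v.1 u.1) ++
      v :: s.filter fun u => !leBits v.1 u.1) s).Perm (l ++ s) := by
    induction l with
    | nil => simp
    | cons v l ih =>
      intro s
      refine (ih _).trans ?_
      refine ((List.perm_middle.trans
        ((List.filter_append_perm _ s).cons v)).append_left l).trans ?_
      exact List.perm_middle
  simpa [sortVoters] using key []

theorem sortVoters_pairwise (l : List (List Bool × Pref m)) :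
    (sortVoters l).Pairwise fun u v => bitsVal v.1 ≤ bitsVal u.1 := by
  have key : ∀ s : List (List Bool × Pref m), s.Pairwise (fun u v => bitsVal v.1 ≤ bitsVal u.1) →
      (l.foldl (fun s v => s.filter (fun u => leBits v.1 u.1) ++
        v :: s.filter fun u => !leBits v.1 u.1) s).Pairwise
          fun u v => bitsVal v.1 ≤ bitsVal u.1 := by
    induction l with
    | nil => simp
    | cons v l ih =>
      intro s hs
      refine ih _ ?_
      rw [List.pairwise_append, List.pairwise_cons]
      simp only [List.mem_filter, List.mem_cons, leBits_iff, Bool.not_eq_true', ← Bool.not_eq_true,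
        not_le]
      refine ⟨hs.filter _, ⟨fun u hu => hu.2.le, hs.filter _⟩, ?_⟩
      rintro a ⟨-, ha⟩ b (rfl | ⟨-, hb⟩)
      · exact ha
      · exact hb.le.trans ha
  exact key [] List.Pairwise.nil

theorem exists_equiv_of_perm {α : Type*} {l l' : List α} (h : l.Perm l') :
    ∃ e : Fin l.length ≃ Fin l'.length, ∀ j, l'.get (e j) = l.get j := by
  classical
  have hcard : ∀ (l : List α) (a : α), Fintype.card {j : Fin l.length // l.get j = a} =
      l.count a := by
    intro l a
    rw [Fintype.card_subtype]
    convert! Fin.card_filter_univ_eq_vector_get_eq_count a ⟨l, rfl⟩ using 3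
  have e : ∀ a, {j : Fin l.length // l.get j = a} ≃ {j : Fin l'.length // l'.get j = a} :=
    fun a => Fintype.equivOfCardEq (by rw [hcard, hcard, h.count_eq])
  exact ⟨Equiv.ofFiberEquiv e, Equiv.ofFiberEquiv_map e⟩

/-- The two nested searches decide the game on voters sorted by weight. -/
theorem search_iff_unitProtectable {n : ℕ} {α : Fin (m + 1) → ℕ} (hα : Antitone α)
    {w : Fin n → List Bool} (hw : Antitone fun j => bitsVal (w j)) (τ : Fin n → Pref m)
    (F B : List Bool) :
    search false (allPrefs m) (fun s => leBits (countBits false s) F &&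
      !search true (allPrefs m) (fun s => leBits (countBits true s) B &&
        !noneBeats (List.ofFn fun i => encodeNat (α i)) s) s) (recs w τ fun _ => none) = true ↔
    UnitProtectable α (fun j => bitsVal (w j)) τ (bitsVal F) (bitsVal B) := by
  rw [unitProtectable_iff_thresholds hα hw, search_recs_protect]
  refine exists_congr fun th => ?_
  rw [Bool.and_eq_true, leBits_iff, bitsVal_countBits_recs, Bool.not_eq_true',
    ← Bool.not_eq_true, search_recs_bribe, not_exists]
  have h1 : ∀ j : Fin n, (if (j : ℕ) < th (τ j) then some false else none) = some false ↔
      (j : ℕ) < th (τ j) := fun j => by split_ifs <;> simp_all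
  refine and_congr (by simp only [h1]) (forall_congr' fun th' => ?_)
  have h2 : ∀ j : Fin n, (if (j : ℕ) < th (τ j) then some false
      else if (j : ℕ) < th' (τ j) then some true else none) = some true ↔
      ¬ (j : ℕ) < th (τ j) ∧ (j : ℕ) < th' (τ j) := fun j => by split_ifs <;> simp_all
  rw [Bool.and_eq_true, leBits_iff, bitsVal_countBits_recs, Bool.not_eq_true',
    ← Bool.not_eq_true, noneBeats_recs, not_and, not_not]
  simp only [h2]

/-- The search decides whether the last candidate wins without bribery and can be protected: sorting
the voters affects neither. -/
theorem decideData_iff {α : Fin (m + 1) → ℕ} (hα : Antitone α) (F B : ℕ)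
    (l : List (List Bool × Pref m)) :
    decideData (List.ofFn fun i => encodeNat (α i), encodeNat F, encodeNat B, l) = true ↔
      (∀ c ≠ Fin.last m, ∑ j, bitsVal (l.get j).1 * α ((l.get j).2.symm c) ≤
        ∑ j, bitsVal (l.get j).1 * α ((l.get j).2.symm (Fin.last m))) ∧
      UnitProtectable α (fun j => bitsVal (l.get j).1) (fun j => (l.get j).2) F B := by
  rw [decideData]
  have hsort := sortVoters_pairwise l
  have hperm := sortVoters_perm l
  dsimp only
  generalize sortVoters l = vs at *
  obtain ⟨e, he⟩ := exists_equiv_of_perm hperm.symm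
  have hw : Antitone fun j => bitsVal (vs.get j).1 := by
    intro i j hij
    rcases hij.lt_or_eq with h | rfl
    · exact List.pairwise_iff_get.1 hsort i j h
    · exact le_rfl
  have hs : (vs.map fun v => ((v.1, v.2, none) : Rec m)) =
      recs (fun j => (vs.get j).1) (fun j => (vs.get j).2) fun _ => none := by
    apply List.ext_getElem <;> simp [recs]
  have h1 : UnitProtectable α (fun j => bitsVal (l.get j).1) (fun j => (l.get j).2) F B ↔
      UnitProtectable α (fun j => bitsVal (vs.get j).1) (fun j => (vs.get j).2) F B :=
    ⟨unitProtectable_congr e (fun j => by rw [he]) (fun j => by rw [he]),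
      unitProtectable_congr e.symm (fun j => by rw [← he, e.apply_symm_apply])
        (fun j => by rw [← he, e.apply_symm_apply])⟩
  have h2 : ∀ c : Fin (m + 1), ∑ j, bitsVal (l.get j).1 * α ((l.get j).2.symm c) =
      ∑ j, bitsVal (vs.get j).1 * α ((vs.get j).2.symm c) := by
    intro c
    rw [← Equiv.sum_comp e]
    simp only [he]
  rw [h1, hs, Bool.and_eq_true, noneBeats_recs, search_iff_unitProtectable hα hw,
    bitsVal_encodeNat, bitsVal_encodeNat]
  simp only [h2, reduceCtorEq, if_false]

theorem WeightedProtectionInstance.decideData_data_iff (I : WeightedProtectionInstance (m + 1)) :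
    decideData I.data = true ↔ I.LastWins ∧
      I.DestructivelyProtectable (fun _ => 1) (fun _ => 1) I.defenseBudget I.attackBudget := by
  rw [Election.destructivelyProtectable_iff, WeightedProtectionInstance.data,
    decideData_iff I.rule.antitone_score]
  let e : Fin (I.voters.map fun v => (encodeNat v.weight, v.pref)).length ≃ I.V :=
    finCongr (by simp)
  have hw : ∀ j, I.weight (e j) =
      bitsVal ((I.voters.map fun v => (encodeNat v.weight, v.pref)).get j).1 := by
    intro j
    simp [Election.weight, e]
  have hτ : ∀ j, I.pref (e j) =
      ((I.voters.map fun v => (encodeNat v.weight, v.pref)).get j).2 := by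
    intro j
    simp [Election.pref, e]
  refine and_congr ?_ ⟨unitProtectable_congr e hw hτ, unitProtectable_congr e.symm
    (fun j => by rw [← hw, e.apply_symm_apply]) (fun j => by rw [← hτ, e.apply_symm_apply])⟩
  simp only [Election.LastWins, Election.totalScore, ← Equiv.sum_comp e, hw, hτ]
  refine forall_congr' fun c => ⟨fun h => ?_, fun h _ => h⟩
  by_cases hc : c = Fin.last m
  · rw [hc]
  · exact h hc

end

theorem theorem3 (m : ℕ) : InP (destructiveWeightedProtection m) := by
  have h1 : PolyFn fun x =>
      (parse x : Bool × InstanceData m).1 && decideData (m := m) (parse x).2 :=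
    PolyFn.parse.fst.and (PolyFn.decideData PolyFn.parse.snd)
  refine inP_of_polyFn h1 fun x => ?_
  rw [Bool.and_eq_true]
  constructor
  · rintro ⟨hx, hd⟩
    obtain ⟨I, rfl⟩ := exists_instance_of_parse x hx
    rw [parse_encode, I.decideData_data_iff] at hd
    exact ⟨I, rfl, hd⟩
  · rintro ⟨I, rfl, hI⟩
    rw [parse_encode]
    exact ⟨rfl, I.decideData_data_iff.2 hI⟩
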